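/- Let $\mathbb{K}=\mathbb{R}$ or $\mathbb{C}$; "analytic" means real analytic or holomorphic accordingly, and manifolds are finite-dimensional, Hausdorff and second countable (for $H$: Hausdorff). **Lie group.** Let $H$ be a Lie group over $\mathbb{K}$ and $|\cdot|$ a norm on its Lie algebra $\mathfrak{h}$ such that $\exp$ is a diffeomorphism on the closed unit ball and $|[u,v]|\le|u||v|$. Let $\log$ be the inverse of $\exp$ restricted to the closed unit ball $B_1(0)$, and let $d$ be the distance of the Finsler metric on $H$ obtained by left translation of the norm ($d=\infty$ between different components). Let $W\subset H$ be an open neighbourhood of the identity $e$ and let $K\subset H$ be a compact set whose interior contains $\overline{W}$. **Local groupoids.** A local analytic groupoid $\mathcal{H}\rightrightarrows\mathcal{H}_0$ consists of analytic manifolds, analytic surjective submersions $s,t:\mathcal{H}\to\mathcal{H}_0$, an analytic unit map, an analytic inversion defined on an open neighbourhood of the units, and an analytic multiplication defined on an open subset of $\mathcal{H}^{(2)}=\{(q,p): s(q)=t(p)\}$ that contains the pairs $(1_x,1_x)$, satisfying the groupoid identities where defined; if $(r,q)$, $(q,p)$ and $(rq,p)$ can be multiplied, then so can $(r,qp)$,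 and $(rq)p=r(qp)$. An s-proper core is a real analytic submanifold $\mathcal{K}\subset\mathcal{H}$ such that $s_{\mathcal{K}}=s|_{\mathcal{K}}$ is a proper surjective submersion, such that every $(k,p)\in\mathcal{H}^{(2)}_{\mathcal{K}}:=\{(k,p)\in\mathcal{H}^{(2)}: k\in\mathcal{K}\}$ can be multiplied, and such that right multiplication by $k\in\mathcal{K}$ is a real analytic diffeomorphism of the fibre $\mathcal{K}_{t(k)}=s_{\mathcal{K}}^{-1}(t(k))$ onto $\mathcal{K}_{s(k)}$. An analytic Haar density on $\mathcal{K}$ is a real analytic section $\mu$ of the bundle of $\mathbb{K}$-valued densities along the fibres of $s_{\mathcal{K}}$ such that $\int_{\mathcal{K}_z}\mu^z=1$ for all $z\in\mathcal{H}_0$, such that $\mu$ is invariant under the right action of $\mathcal{K}$ on $\mathcal{K}$, and such that integration of analytic functions on $\mathcal{H}$ along the fibres of $s_{\mathcal{K}}$ gives analytic functions on $\mathcal{H}_0$, also after a change of base along a submersion. **Averaging.** For a map $\phi:\mathcal{H}\to H$ put $$\psi_\phi(k,p)=\phi(p)^{-1}\phi(k)^{-1}\phi(kp)\quad\text{for }(k,p)\in\mathcal{H}^{(2)}_{\mathcal{K}},\qquad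 \Delta(\phi)=\sup_{(k,p)\in\mathcal{H}^{(2)}_{\mathcal{K}}} d(\psi_\phi(k,p),e),$$ $$A_{\mathcal{K}}(\phi)(p)=\exp\Big(\int_{\mathcal{K}_{t(p)}}\log\psi_\phi(k,p)\,\mu^{t(p)}(k)\Big),\qquad \hat\phi=\phi\cdot A_{\mathcal{K}}(\phi).$$ **Theorem.** For every $T\ge 0$ there is a constant $C=C(H,|\cdot|,W,K,T)>0$ with the following property. Let $\mathcal{H}\rightrightarrows\mathcal{H}_0$ be a local analytic groupoid over $\mathbb{K}$, let $\mathcal{K}$ be an s-proper core of it and let $\mu$ be an analytic Haar density on $\mathcal{K}$ such that every $\mu^z$, $z\in\mathcal{H}_0$, has total variation at most $T$ (if $\mu\ge0$ one can take $T=1$, so that $C=C(H,|\cdot|,W,K)$). Let $\phi:\mathcal{H}\to H$ be an analytic map with $\phi(\mathcal{H})\subset W$ and $\Delta(\phi)\le C$. Then the iterates $\phi_0=\phi$, $\phi_{m+1}=\hat\phi_m$ are well defined (every $\psi_{\phi_m}$ takes values in $\exp(B_1(0))$ and the integrals exist) and continuous, and they converge in $C^0$ on compact subsets of $\mathcal{H}$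 (uniformly on compact sets with respect to $d$) to a continuous map $\Phi:\mathcal{H}\to H$ with $$\Phi(kp)=\Phi(k)\Phi(p)\qquad\text{for all }(k,p)\in\mathcal{H}^{(2)}_{\mathcal{K}}.$$ -/

import Mathlib

open Set Filter Topology MeasureTheory Manifold
open scoped ContDiff ENNReal NNReal

universe u v w

noncomputable section

/-- The model space `𝕜ⁿ`, with `𝕜 = ℝ` or `ℂ`. -/
abbrev Mdl (𝕜 : Type) [RCLike 𝕜] (n : ℕ) : Type := EuclideanSpace 𝕜 (Fin n)

/-! ### Lie groups with a normed Lie algebra -/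

namespace NormedLie

variable {𝕜 : Type} [RCLike 𝕜] {n : ℕ} {H : Type*} [TopologicalSpace H]
  [ChartedSpace (Mdl 𝕜 n) H] [Group H]

/-- The Lie algebra of `H`: the tangent space at the identity, with Mathlib's bracket. -/
abbrev Alg (𝕜 : Type) [RCLike 𝕜] (n : ℕ) (H : Type*) [TopologicalSpace H]
    [ChartedSpace (Mdl 𝕜 n) H] [Group H] : Type :=
  GroupLieAlgebra 𝓘(𝕜, Mdl 𝕜 n) H

/-- `γ` is the one-parameter subgroup of `H` with initial velocity `v`. -/
def IsOneParameterSubgroup (v : Alg 𝕜 n H) (γ : ℝ → H) : Prop :=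
  (∀ a b : ℝ, γ (a + b) = γ a * γ b) ∧
    HasMFDerivAt 𝓘(ℝ, ℝ) 𝓘(ℝ, Mdl 𝕜 n) γ 0
      (ContinuousLinearMap.toSpanSingleton ℝ (v : Mdl 𝕜 n))

open Classical in
/-- The exponential map: the value at time `1` of the one-parameter subgroup with velocity `v`. -/
def lieExp (v : Alg 𝕜 n H) : H :=
  if h : ∃ γ : ℝ → H, IsOneParameterSubgroup v γ then h.choose 1 else 1

/-- A norm on the (real vector space underlying the) Lie algebra, normalised so that the
exponential map is a diffeomorphism on the closed unit ball and `|[u,v]| ≤ |u||v|`. -/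
structure IsLieNorm (N : Alg 𝕜 n H → ℝ) : Prop where
  add_le : ∀ u v, N (u + v) ≤ N u + N v
  smul_eq : ∀ (r : ℝ) (v), N ((r : 𝕜) • v) = |r| * N v
  eq_zero : ∀ v, N v = 0 → v = 0
  bracket_le : ∀ u v : Alg 𝕜 n H, N ⁅u, v⁆ ≤ N u * N v
  exp_diffeo : ∃ Φ : PartialDiffeomorph 𝓘(𝕜, Mdl 𝕜 n) 𝓘(𝕜, Mdl 𝕜 n) (Mdl 𝕜 n) H ∞,
    (∀ v : Alg 𝕜 n H, N v ≤ 1 → (v : Mdl 𝕜 n) ∈ Φ.source) ∧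
    ∀ v : Alg 𝕜 n H, (v : Mdl 𝕜 n) ∈ Φ.source → Φ (v : Mdl 𝕜 n) = lieExp v

/-- The image of the closed unit ball under the exponential map. -/
def expBall (N : Alg 𝕜 n H → ℝ) : Set H := lieExp '' {v | N v ≤ 1}

open Classical in
/-- The logarithm: the inverse of the exponential map of the closed unit ball
(with the value `0` outside of `expBall N`). -/
def lieLog (N : Alg 𝕜 n H → ℝ) (g : H) : Alg 𝕜 n H :=
  if h : ∃ v : Alg 𝕜 n H, N v ≤ 1 ∧ lieExp v = g then h.choose else 0

/-- The Finsler metric obtained from `N` by left translation. -/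
@[reducible] def leftFinsler (N : Alg 𝕜 n H → ℝ) (g : H) : ENorm (TangentSpace 𝓘(ℝ, Mdl 𝕜 n) g) where
  enorm v := ENNReal.ofReal
    (N (mfderiv 𝓘(𝕜, Mdl 𝕜 n) 𝓘(𝕜, Mdl 𝕜 n) (fun x : H => g⁻¹ * x) g (v : Mdl 𝕜 n)))

/-- The distance of the left invariant Finsler metric: the infimum of the lengths of `C¹` paths
(`∞` between different components). -/
def finslerEDist (N : Alg 𝕜 n H → ℝ) (x y : H) : ℝ≥0∞ :=
  letI := leftFinsler N
  Manifold.riemannianEDist 𝓘(ℝ, Mdl 𝕜 n) x y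

end NormedLie

/-! ### Local analytic groupoids -/

/-- A local analytic groupoid over `𝕜 = ℝ` or `ℂ` with manifold of arrows `A` and manifold of units
`B`. An arrow `p` goes from `source p` to `target p`; `mul q p` is the product `q p`, meaningful for
`(q, p) ∈ mulDom`, and `inv` is meaningful on `invDom`. -/
structure LocalAnalyticGroupoid (𝕜 : Type) [RCLike 𝕜] (a b : ℕ) (A B : Type*)
    [TopologicalSpace A] [ChartedSpace (Mdl 𝕜 a) A]
    [TopologicalSpace B] [ChartedSpace (Mdl 𝕜 b) B] where
  source : A → B
  target : A → B
  unit : B → A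
  inv : A → A
  invDom : Set A
  mul : A → A → A
  mulDom : Set (A × A)
  source_surjective : Function.Surjective source
  target_surjective : Function.Surjective target
  source_submersion : IsSubmersion 𝓘(𝕜, Mdl 𝕜 a) 𝓘(𝕜, Mdl 𝕜 b) ω source
  target_submersion : IsSubmersion 𝓘(𝕜, Mdl 𝕜 a) 𝓘(𝕜, Mdl 𝕜 b) ω target
  unit_analytic : ContMDiff 𝓘(𝕜, Mdl 𝕜 b) 𝓘(𝕜, Mdl 𝕜 a) ω unit
  source_unit : ∀ x, source (unit x) = x
  target_unit : ∀ x, target (unit x) = x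
  /-- the domain of the multiplication is open in the space of composable pairs -/
  mulDom_open : ∃ U : Set (A × A), IsOpen U ∧ mulDom = U ∩ {x | source x.1 = target x.2}
  unit_unit_mem : ∀ x, (unit x, unit x) ∈ mulDom
  mul_analytic : ContMDiffOn (𝓘(𝕜, Mdl 𝕜 a).prod 𝓘(𝕜, Mdl 𝕜 a)) 𝓘(𝕜, Mdl 𝕜 a) ω
    (fun x : A × A => mul x.1 x.2) mulDom
  source_mul : ∀ q p, (q, p) ∈ mulDom → source (mul q p) = source p
  target_mul : ∀ q p, (q, p) ∈ mulDom → target (mul q p) = target q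
  unit_mul : ∀ p, (unit (target p), p) ∈ mulDom → mul (unit (target p)) p = p
  mul_unit : ∀ p, (p, unit (source p)) ∈ mulDom → mul p (unit (source p)) = p
  invDom_open : IsOpen invDom
  unit_mem_invDom : ∀ x, unit x ∈ invDom
  inv_analytic : ContMDiffOn 𝓘(𝕜, Mdl 𝕜 a) 𝓘(𝕜, Mdl 𝕜 a) ω inv invDom
  source_inv : ∀ p ∈ invDom, source (inv p) = target p
  target_inv : ∀ p ∈ invDom, target (inv p) = source p
  inv_mul : ∀ p ∈ invDom, (inv p, p) ∈ mulDom ∧ mul (inv p) p = unit (source p)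
  mul_inv : ∀ p ∈ invDom, (p, inv p) ∈ mulDom ∧ mul p (inv p) = unit (target p)
  mul_assoc : ∀ r q p, (r, q) ∈ mulDom → (q, p) ∈ mulDom → (mul r q, p) ∈ mulDom →
    (r, mul q p) ∈ mulDom ∧ mul (mul r q) p = mul r (mul q p)

/-- `Φ` is a real analytic chart of `A` in which the subset `S` is the linear subspace `F`. -/
def IsSliceChart {𝕜 : Type} [RCLike 𝕜] {a : ℕ} {A : Type*} [TopologicalSpace A]
    [ChartedSpace (Mdl 𝕜 a) A] (S : Set A)
    (Φ : PartialDiffeomorph 𝓘(ℝ, Mdl 𝕜 a) 𝓘(ℝ, Mdl 𝕜 a) A (Mdl 𝕜 a) ω)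
    (F : Submodule ℝ (Mdl 𝕜 a)) : Prop :=
  ∀ y ∈ Φ.source, y ∈ S ↔ Φ y ∈ F

namespace LocalAnalyticGroupoid

variable {𝕜 : Type} [RCLike 𝕜] {a b : ℕ} {A B : Type*}
  [TopologicalSpace A] [ChartedSpace (Mdl 𝕜 a) A]
  [TopologicalSpace B] [ChartedSpace (Mdl 𝕜 b) B]

/-- The fibre over `z` of the restriction of the source map to `K`. -/
def fibre (G : LocalAnalyticGroupoid 𝕜 a b A B) (K : Set A) (z : B) : Set A :=
  {k | k ∈ K ∧ G.source k = z}

/-- The composable pairs `(k, p)` with `k ∈ K`. -/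
def corePairs (G : LocalAnalyticGroupoid 𝕜 a b A B) (K : Set A) : Set (A × A) :=
  {x | x.1 ∈ K ∧ G.source x.1 = G.target x.2}

/-- An s-proper core of a local analytic groupoid. -/
structure IsSProperCore (G : LocalAnalyticGroupoid 𝕜 a b A B) (K : Set A) : Prop where
  /-- `K` is a real analytic submanifold -/
  submanifold : ∀ k ∈ K, ∃ Φ F, k ∈ Φ.source ∧ IsSliceChart (𝕜 := 𝕜) (a := a) K Φ F
  /-- the source map restricts to a submersion on `K`: its differential maps the tangent space of
  `K` onto the tangent space of the manifold of units -/
  submersion : ∀ k ∈ K, ∀ Φ F, k ∈ Φ.source → IsSliceChart (𝕜 := 𝕜) (a := a) K Φ F →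
    ∀ w : TangentSpace 𝓘(𝕜, Mdl 𝕜 b) (G.source k), ∃ v : Mdl 𝕜 a,
      (mfderiv 𝓘(ℝ, Mdl 𝕜 a) 𝓘(ℝ, Mdl 𝕜 a) Φ k v : Mdl 𝕜 a) ∈ F ∧
      mfderiv 𝓘(𝕜, Mdl 𝕜 a) 𝓘(𝕜, Mdl 𝕜 b) G.source k v = w
  surjective : ∀ z, (G.fibre K z).Nonempty
  /-- right multiplication by `k ∈ K` identifies the fibres of the source map of `K` -/
  right_mul : ∀ k ∈ K,
    MapsTo (fun l => G.mul l k) (G.fibre K (G.target k)) (G.fibre K (G.source k)) ∧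
    ∃ g : A → A, MapsTo g (G.fibre K (G.source k)) (G.fibre K (G.target k)) ∧
      InvOn g (fun l => G.mul l k) (G.fibre K (G.target k)) (G.fibre K (G.source k)) ∧
      ContMDiffOn 𝓘(ℝ, Mdl 𝕜 a) 𝓘(ℝ, Mdl 𝕜 a) ω g (G.fibre K (G.source k))
  /-- arrows of `K` multiply from the left without restriction -/
  no_escape : G.corePairs K ⊆ G.mulDom
  s_proper : IsProperMap (fun k : K => G.source k)

/-- A real analytic chart of `K` adapted to the source map: coordinates `(z, y)` on `K ∩ amb`, with
`z` the source and `y ∈ ℝᵈ` a coordinate along the fibres. -/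
structure FibredChart (G : LocalAnalyticGroupoid 𝕜 a b A B) (K : Set A) where
  d : ℕ
  amb : Set A
  dom : Set (B × EuclideanSpace ℝ (Fin d))
  param : B × EuclideanSpace ℝ (Fin d) → A
  coord : A → EuclideanSpace ℝ (Fin d)
  amb_open : IsOpen amb
  dom_open : IsOpen dom
  param_analytic : ContMDiffOn (𝓘(ℝ, Mdl 𝕜 b).prod 𝓘(ℝ, EuclideanSpace ℝ (Fin d)))
    𝓘(ℝ, Mdl 𝕜 a) ω param dom
  coord_analytic : ContMDiffOn 𝓘(ℝ, Mdl 𝕜 a) 𝓘(ℝ, EuclideanSpace ℝ (Fin d)) ω coord (K ∩ amb)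
  param_mem : ∀ x ∈ dom, param x ∈ K ∩ amb
  source_param : ∀ x ∈ dom, G.source (param x) = x.1
  coord_param : ∀ x ∈ dom, coord (param x) = x.2
  mem_dom : ∀ k ∈ K ∩ amb, (G.source k, coord k) ∈ dom
  param_coord : ∀ k ∈ K ∩ amb, param (G.source k, coord k) = k

/-- Integration of a vector valued function against a `𝕜`-valued measure. -/
def integralAgainst [MeasurableSpace A] {V : Type*} [NormedAddCommGroup V] [NormedSpace 𝕜 V]
    [NormedSpace ℝ V] [IsScalarTower ℝ 𝕜 V] (ν : VectorMeasure A 𝕜) (f : A → V) : V :=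
  ν.integral f (ContinuousLinearMap.lsmul ℝ 𝕜 : 𝕜 →L[ℝ] V →L[ℝ] V).flip

end LocalAnalyticGroupoid

/-- A normalised analytic Haar density on an s-proper core `K`. A `𝕜`-valued density along the
fibres of the source map of `K` is given by the family of the measures `μ z` on the fibres that it
defines; it is a real analytic section when `μ z` has a real analytic density with respect to
Lebesgue measure in fibred charts. -/
structure LocalAnalyticGroupoid.IsHaarDensity {𝕜 : Type} [RCLike 𝕜] {a b : ℕ}
    {A : Type u} {B : Type v}
    [TopologicalSpace A] [ChartedSpace (Mdl 𝕜 a) A] [MeasurableSpace A]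
    [TopologicalSpace B] [ChartedSpace (Mdl 𝕜 b) B]
    (G : LocalAnalyticGroupoid 𝕜 a b A B) (K : Set A) (μ : B → VectorMeasure A 𝕜) : Prop where
  /-- `μ z` lives on the fibre over `z` -/
  supported : ∀ z S, MeasurableSet S → Disjoint S (G.fibre K z) → μ z S = 0
  analytic_density : ∀ k ∈ K, ∃ c : G.FibredChart K, k ∈ c.amb ∧
    ∃ ρ : B × EuclideanSpace ℝ (Fin c.d) → 𝕜,
      ContMDiffOn (𝓘(ℝ, Mdl 𝕜 b).prod 𝓘(ℝ, EuclideanSpace ℝ (Fin c.d))) 𝓘(ℝ, 𝕜) ω ρ c.dom ∧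
      ∀ z, IntegrableOn (fun y => ρ (z, y)) {y | (z, y) ∈ c.dom} ∧
        ∀ S, MeasurableSet S → S ⊆ c.amb →
          μ z S = ∫ y in {y | (z, y) ∈ c.dom ∧ c.param (z, y) ∈ S}, ρ (z, y)
  normalised : ∀ z, μ z univ = 1
  /-- invariance under the right action of `K` on `K` -/
  right_invariant : ∀ k ∈ K, ∀ S, MeasurableSet S →
    μ (G.target k) {l | l ∈ G.fibre K (G.target k) ∧ G.mul l k ∈ S} = μ (G.source k) S
  /-- integration along the fibres preserves analyticity (over `𝕜`) of functions -/
  integral_analytic : ∀ f : A → 𝕜, ContMDiff 𝓘(𝕜, Mdl 𝕜 a) 𝓘(𝕜, 𝕜) ω f →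
    ContMDiff 𝓘(𝕜, Mdl 𝕜 b) 𝓘(𝕜, 𝕜) ω
      (fun z => LocalAnalyticGroupoid.integralAgainst (μ z) f)
  /-- the same after a change of base along a submersion `g : Y → B`; here `f` is an analytic
  function on the pullback of the source map along `g` -/
  integral_analytic_baseChange : ∀ (n : ℕ) (Y : Type u) [TopologicalSpace Y] [T2Space Y]
    [SecondCountableTopology Y] [ChartedSpace (Mdl 𝕜 n) Y] [IsManifold 𝓘(𝕜, Mdl 𝕜 n) ω Y]
    (g : Y → B) (f : Y × A → 𝕜), IsSubmersion 𝓘(𝕜, Mdl 𝕜 n) 𝓘(𝕜, Mdl 𝕜 b) ω g →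
    ContMDiffOn (𝓘(𝕜, Mdl 𝕜 n).prod 𝓘(𝕜, Mdl 𝕜 a)) 𝓘(𝕜, 𝕜) ω f {x | g x.1 = G.source x.2} →
    ContMDiff 𝓘(𝕜, Mdl 𝕜 n) 𝓘(𝕜, 𝕜) ω
      (fun y => LocalAnalyticGroupoid.integralAgainst (μ (g y)) (fun k => f (y, k)))

/-! ### Averaging -/

namespace LocalAnalyticGroupoid

open NormedLie

variable {𝕜 : Type} [RCLike 𝕜] {a b n : ℕ} {A B H : Type*}
  [TopologicalSpace A] [ChartedSpace (Mdl 𝕜 a) A] [MeasurableSpace A]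
  [TopologicalSpace B] [ChartedSpace (Mdl 𝕜 b) B]
  [TopologicalSpace H] [ChartedSpace (Mdl 𝕜 n) H] [Group H]

/-- `ψ(k, p) = φ(p)⁻¹ φ(k)⁻¹ φ(k p)`. -/
def psi (G : LocalAnalyticGroupoid 𝕜 a b A B) (φ : A → H) (k p : A) : H :=
  (φ p)⁻¹ * (φ k)⁻¹ * φ (G.mul k p)

/-- The defect `Δ(φ)`: the largest distance from a value of `ψ` on the composable pairs `(k, p)`
with `k ∈ K` to the identity. -/
def defect (G : LocalAnalyticGroupoid 𝕜 a b A B) (K : Set A) (N : Alg 𝕜 n H → ℝ)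
    (φ : A → H) : ℝ≥0∞ :=
  ⨆ x ∈ G.corePairs K, finslerEDist N (G.psi φ x.1 x.2) 1

/-- The function `k ↦ log ψ(k, p)`, as a function to the vector space `𝕜ⁿ` underlying the
Lie algebra. -/
def logPsi (G : LocalAnalyticGroupoid 𝕜 a b A B) (N : Alg 𝕜 n H → ℝ) (φ : A → H) (p k : A) :
    Mdl 𝕜 n :=
  lieLog N (G.psi φ k p)

/-- The average `A(φ)(p) = exp (∫ log ψ(k, p) μ(k))`, over the `k` in the core with source the
target of `p`. -/
def average (G : LocalAnalyticGroupoid 𝕜 a b A B) (μ : B → VectorMeasure A 𝕜)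
    (N : Alg 𝕜 n H → ℝ) (φ : A → H) (p : A) : H :=
  lieExp (𝕜 := 𝕜) (n := n)
    (integralAgainst (V := Mdl 𝕜 n) (μ (G.target p)) (G.logPsi N φ p))

/-- The corrected map `φ · A(φ)`. -/
def correct (G : LocalAnalyticGroupoid 𝕜 a b A B) (μ : B → VectorMeasure A 𝕜)
    (N : Alg 𝕜 n H → ℝ) (φ : A → H) (p : A) : H :=
  φ p * G.average μ N φ p

end LocalAnalyticGroupoid

end

/-! Expanding `φ(lkp)` in two ways gives a twisted cocycle identity for the defect: `ψ(k,p) ψ(l,kp)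
= φ(p)⁻¹ ψ(l,k) φ(p) ψ(lk,p)` (`IsSProperCore.psi_mul_psi`). When `ψ` is `exp` of vectors of size at
most `δ`, the logarithms satisfy the linearised identity up to `O(δ²)`, uniformly as long as `φ(p)`
stays in a fixed compact set (`exists_linearisation`).

Integrate this linear identity over `l`, writing `α(p) = ∫ log ψ(l,p)`. Normalisation of the Haar
density leaves `log ψ(k,p)` unchanged, and right invariance turns the average of `log ψ(lk,p)` into
`α(p)`. Hence the products `ψ(k,p) exp α(kp)` and `φ(p)⁻¹ exp α(k) φ(p) exp α(p)` agree to first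
order (`norm_linearisation_average_le`). Their quotient is exactly the defect of the corrected map
`φ exp α` (`psi_correct`), so the new defect is `O(δ²)`. As in Newton's method the improvement is
quadratic, but it is enough that a small defect is at least halved (`exists_correct_step`).

The corrections then form a geometric series. Its total is small, so the iterates never leave the
compact set on which the constants are valid, and they converge to a map whose defect vanishes.

Two supplements are needed. The Finsler distance is compared with the Euclidean norm in exponential
coordinates (`exists_finslerEDist_mul_le`, `exists_of_finslerEDist_one_le`), and the average must be
continuous in order to iterate (`continuous_integralAgainst`). -/

noncomputable section

/-! ### From `𝕜`-smooth to real smooth structures, on which paths and lengths live. -/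

section RestrictScalars

variable {𝕜 : Type} [RCLike 𝕜] {m k : ℕ} {X Y : Type*}
  [TopologicalSpace X] [ChartedSpace (Mdl 𝕜 m) X]
  [TopologicalSpace Y] [ChartedSpace (Mdl 𝕜 k) Y]

lemma ContMDiffWithinAt.restrictScalars_real {f : X → Y} {s : Set X} {x : X} {r : ℕ∞ω}
    (h : ContMDiffWithinAt 𝓘(𝕜, Mdl 𝕜 m) 𝓘(𝕜, Mdl 𝕜 k) r f s x) :
    ContMDiffWithinAt 𝓘(ℝ, Mdl 𝕜 m) 𝓘(ℝ, Mdl 𝕜 k) r f s x := by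
  rw [contMDiffWithinAt_iff] at h ⊢
  exact ⟨h.1, h.2.restrict_scalars ℝ⟩

lemma HasMFDerivAt.restrictScalars_real {f : X → Y} {x : X} {f' : Mdl 𝕜 m →L[𝕜] Mdl 𝕜 k}
    (h : HasMFDerivAt 𝓘(𝕜, Mdl 𝕜 m) 𝓘(𝕜, Mdl 𝕜 k) f x f') :
    HasMFDerivAt 𝓘(ℝ, Mdl 𝕜 m) 𝓘(ℝ, Mdl 𝕜 k) f x (f'.restrictScalars ℝ) :=
  ⟨h.1, h.2.restrictScalars ℝ⟩

lemma isManifold_real (𝕜 : Type) [RCLike 𝕜] (m : ℕ) (X : Type*) [TopologicalSpace X]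
    [ChartedSpace (Mdl 𝕜 m) X] (r : ℕ∞ω) [IsManifold 𝓘(𝕜, Mdl 𝕜 m) r X] :
    IsManifold 𝓘(ℝ, Mdl 𝕜 m) r X := by
  apply isManifold_of_contDiffOn
  intro e e' he he'
  have h := HasGroupoid.compatible (G := contDiffGroupoid r 𝓘(𝕜, Mdl 𝕜 m)) he he'
  exact ((contDiffGroupoid r 𝓘(𝕜, Mdl 𝕜 m)).mem_iff_of_eqOnSource
    (Setoid.refl _) |>.1 h).1.restrict_scalars ℝ

end RestrictScalars

/-! ### The exponential map at the origin. -/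

namespace NormedLie

variable {𝕜 : Type} [RCLike 𝕜] {n : ℕ} {H : Type*} [TopologicalSpace H]
  [ChartedSpace (Mdl 𝕜 n) H] [Group H]

/-- The exponential map as a map on the model space underlying the Lie algebra. -/
def mdlExp (𝕜 : Type) [RCLike 𝕜] (n : ℕ) (H : Type*) [TopologicalSpace H]
    [ChartedSpace (Mdl 𝕜 n) H] [Group H] (v : Mdl 𝕜 n) : H :=
  lieExp (𝕜 := 𝕜) (n := n) (v : Alg 𝕜 n H)

/-- The logarithm as a map to the model space underlying the Lie algebra. -/
def mdlLog (N : Alg 𝕜 n H → ℝ) (g : H) : Mdl 𝕜 n := lieLog N g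

/-- The norm on the Lie algebra as a function on the underlying model space. -/
def mdlNorm (N : Alg 𝕜 n H → ℝ) (v : Mdl 𝕜 n) : ℝ := N (v : Alg 𝕜 n H)

section

variable [LieGroup 𝓘(𝕜, Mdl 𝕜 n) ω H]

lemma mdifferentiableAt_mul_left (g x : H) :
    MDifferentiableAt 𝓘(𝕜, Mdl 𝕜 n) 𝓘(𝕜, Mdl 𝕜 n) (fun y : H => g * y) x :=
  (contMDiff_mul_left (I := 𝓘(𝕜, Mdl 𝕜 n)) (n := ω)).contMDiffAt.mdifferentiableAt (by simp)

/-- The homomorphism law carries the zero velocity at time `0` to every time, so `γ` and the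
constant curve are both integral curves of the zero field and agree by uniqueness. Since `lieExp`
chooses some one-parameter subgroup, this is what determines its value at `0`. -/
lemma IsOneParameterSubgroup.eq_one [T2Space H] {γ : ℝ → H}
    (h : IsOneParameterSubgroup (0 : Alg 𝕜 n H) γ) (t : ℝ) : γ t = 1 := by
  obtain ⟨hmul, hder⟩ := h
  have h0 : γ 0 = 1 := by
    have := hmul 0 0
    simpa using this
  have : IsManifold 𝓘(𝕜, Mdl 𝕜 n) ω H := inferInstance
  have : IsManifold 𝓘(ℝ, Mdl 𝕜 n) ω H := isManifold_real 𝕜 n H ω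
  have : IsManifold 𝓘(ℝ, Mdl 𝕜 n) 1 H := .of_le (n := ω) (by simp)
  have key : ∀ s : ℝ, HasMFDerivAt 𝓘(ℝ, ℝ) 𝓘(ℝ, Mdl 𝕜 n) γ s
      (0 : ℝ →L[ℝ] Mdl 𝕜 n) := by
    intro s
    have h1 : HasMFDerivAt 𝓘(ℝ, ℝ) 𝓘(ℝ, ℝ) (fun x : ℝ => x - s) s
        (ContinuousLinearMap.id ℝ ℝ) :=
      ((hasFDerivAt_id s).sub_const s).hasMFDerivAt
    have h2 := (mdifferentiableAt_mul_left (𝕜 := 𝕜) (n := n) (γ s) (γ 0)).hasMFDerivAt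
    have h2' := HasMFDerivAt.restrictScalars_real h2
    have hder' : HasMFDerivAt 𝓘(ℝ, ℝ) 𝓘(ℝ, Mdl 𝕜 n) γ (s - s) (0 : ℝ →L[ℝ] Mdl 𝕜 n) := by
      rw [sub_self]
      refine hder.congr_mfderiv ?_
      ext1
      exact smul_zero (M := ℝ) (A := Mdl 𝕜 n) 1
    rw [← sub_self s] at h2'
    have h3 := h2'.comp s (HasMFDerivAt.comp (g := γ) (f := fun x : ℝ => x - s) s hder' h1)
    have h4 : (fun y : H => γ s * y) ∘ γ ∘ (fun x : ℝ => x - s) = γ := by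
      ext x
      simp [← hmul]
    rw [h4] at h3
    refine h3.congr_mfderiv ?_
    ext1
    exact map_zero (mfderiv 𝓘(𝕜, Mdl 𝕜 n) 𝓘(𝕜, Mdl 𝕜 n) (fun y : H => γ s * y) (γ (s - s)) :
      Mdl 𝕜 n →L[𝕜] Mdl 𝕜 n)
  have hγ : IsMIntegralCurve γ (fun x : H => (0 : TangentSpace 𝓘(ℝ, Mdl 𝕜 n) x)) := by
    intro s
    refine (key s).congr_mfderiv ?_
    ext1
    exact (smul_zero (M := ℝ) (A := Mdl 𝕜 n) 1).symm
  have hc : IsMIntegralCurve (fun _ : ℝ => (1 : H))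
      (fun x : H => (0 : TangentSpace 𝓘(ℝ, Mdl 𝕜 n) x)) := by
    intro s
    refine (hasMFDerivAt_const (1 : H) s).congr_mfderiv ?_
    ext1
    exact (smul_zero (M := ℝ) (A := Mdl 𝕜 n) 1).symm
  have := isMIntegralCurve_eq_of_contMDiff (t₀ := 0) (I := 𝓘(ℝ, Mdl 𝕜 n))
    (fun t => BoundarylessManifold.isInteriorPoint)
    (Bundle.contMDiff_zeroSection ℝ (TangentSpace 𝓘(ℝ, Mdl 𝕜 n) : H → Type)) hγ hc h0
  exact congrFun this t

lemma mdlExp_zero [T2Space H] : mdlExp 𝕜 n H 0 = 1 := by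
  have hex : ∃ γ : ℝ → H, IsOneParameterSubgroup (0 : Alg 𝕜 n H) γ := by
    refine ⟨fun _ => 1, by simp, ?_⟩
    refine (hasMFDerivAt_const (1 : H) (0 : ℝ)).congr_mfderiv ?_
    ext1
    exact (smul_zero (M := ℝ) (A := Mdl 𝕜 n) 1).symm
  have : mdlExp 𝕜 n H 0 = hex.choose 1 := dif_pos hex
  rw [this]
  exact hex.choose_spec.eq_one 1

end

end NormedLie

/-! ### The Lie algebra norm, and `exp` and `log` as mutually inverse local diffeomorphisms. -/

namespace NormedLie

variable {𝕜 : Type} [RCLike 𝕜] {n : ℕ} {H : Type*} [TopologicalSpace H]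
  [ChartedSpace (Mdl 𝕜 n) H] [Group H] {N : Alg 𝕜 n H → ℝ}

lemma mem_expBall {g : H} : g ∈ expBall N ↔ ∃ v, mdlNorm N v ≤ 1 ∧ mdlExp 𝕜 n H v = g := Iff.rfl

namespace IsLieNorm

lemma mdlNorm_smul (hN : IsLieNorm N) (r : ℝ) (v : Mdl 𝕜 n) :
    mdlNorm N (r • v) = |r| * mdlNorm N v := by
  have h : r • v = (r : 𝕜) • v := (RCLike.real_smul_eq_coe_smul (K := 𝕜) r v)
  rw [h]
  exact hN.smul_eq r v

lemma mdlNorm_add_le (hN : IsLieNorm N) (u v : Mdl 𝕜 n) :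
    mdlNorm N (u + v) ≤ mdlNorm N u + mdlNorm N v := hN.add_le u v

lemma mdlNorm_zero (hN : IsLieNorm N) : mdlNorm N 0 = 0 := by
  simpa using hN.mdlNorm_smul 0 (0 : Mdl 𝕜 n)

lemma mdlNorm_nonneg (hN : IsLieNorm N) (v : Mdl 𝕜 n) : 0 ≤ mdlNorm N v := by
  have h1 := hN.mdlNorm_add_le v ((-1 : ℝ) • v)
  have h2 := hN.mdlNorm_smul (-1) v
  rw [h2] at h1
  simp [hN.mdlNorm_zero] at h1
  linarith

/-- A norm is convex, and convex functions on a finite-dimensional space are continuous. -/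
lemma continuous_mdlNorm (hN : IsLieNorm N) : Continuous (mdlNorm N) := by
  have hc : ConvexOn ℝ univ (mdlNorm N) := by
    refine ⟨convex_univ, fun u _ v _ a b ha hb _ => ?_⟩
    refine (hN.mdlNorm_add_le _ _).trans ?_
    rw [hN.mdlNorm_smul, hN.mdlNorm_smul, abs_of_nonneg ha, abs_of_nonneg hb]
    rfl
  exact continuousOn_univ.1 (hc.continuousOn isOpen_univ)

lemma exists_mdlNorm_le (hN : IsLieNorm N) : ∃ c > 0, ∀ v, mdlNorm N v ≤ c * ‖v‖ := by
  obtain ⟨c, hc⟩ := (isCompact_sphere (0 : Mdl 𝕜 n) 1).bddAbove_image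
    hN.continuous_mdlNorm.continuousOn
  refine ⟨max c 1, by positivity, fun v => ?_⟩
  rcases eq_or_ne v 0 with rfl | hv
  · simp [hN.mdlNorm_zero]
  have hv' : 0 < ‖v‖ := norm_pos_iff.2 hv
  have h1 : mdlNorm N (‖v‖⁻¹ • v) ≤ c :=
    hc ⟨_, by simp [norm_smul, hv'.ne'], rfl⟩
  rw [hN.mdlNorm_smul, abs_of_pos (inv_pos.2 hv'), inv_mul_le_iff₀ hv'] at h1
  nlinarith [le_max_left c 1]

lemma exists_le_mdlNorm (hN : IsLieNorm N) : ∃ c > 0, ∀ v, ‖v‖ ≤ c * mdlNorm N v := by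
  rcases (Metric.sphere (0 : Mdl 𝕜 n) 1).eq_empty_or_nonempty with he | hne
  -- The unit sphere is empty only when `n = 0`, and there is then no minimum to take.
  · refine ⟨1, one_pos, fun v => ?_⟩
    rcases eq_or_ne v 0 with rfl | hv
    · simp [hN.mdlNorm_zero]
    have hv' : 0 < ‖v‖ := norm_pos_iff.2 hv
    have : (‖v‖⁻¹ • v) ∈ Metric.sphere (0 : Mdl 𝕜 n) 1 := by simp [norm_smul, hv'.ne']
    simp [he] at this
  obtain ⟨x, hx, hmin⟩ := (isCompact_sphere (0 : Mdl 𝕜 n) 1).exists_isMinOn hne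
    hN.continuous_mdlNorm.continuousOn
  have hx0 : 0 < mdlNorm N x := by
    refine lt_of_le_of_ne (hN.mdlNorm_nonneg x) fun h => ?_
    have : x = 0 := hN.eq_zero x h.symm
    simp [this] at hx
  refine ⟨(mdlNorm N x)⁻¹, inv_pos.2 hx0, fun v => ?_⟩
  rcases eq_or_ne v 0 with rfl | hv
  · simp [hN.mdlNorm_zero]
  have hv' : 0 < ‖v‖ := norm_pos_iff.2 hv
  have h1 : mdlNorm N x ≤ mdlNorm N (‖v‖⁻¹ • v) := hmin (by simp [norm_smul, hv'.ne'])
  rw [hN.mdlNorm_smul, abs_of_pos (inv_pos.2 hv')] at h1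
  rw [le_inv_mul_iff₀ hx0, mul_comm]
  rwa [le_inv_mul_iff₀ hv', mul_comm, mul_comm] at h1

lemma exists_ball (hN : IsLieNorm N) : ∃ r > 0, ∀ v : Mdl 𝕜 n, ‖v‖ ≤ r → mdlNorm N v < 1 := by
  obtain ⟨c, hc, h⟩ := hN.exists_mdlNorm_le
  refine ⟨1 / (2 * c), by positivity, fun v hv => (h v).trans_lt ?_⟩
  calc c * ‖v‖ ≤ c * (1 / (2 * c)) := by gcongr
    _ = 1 / 2 := by field_simp
    _ < 1 := by norm_num

lemma exists_partialDiffeomorph (hN : IsLieNorm N) :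
    ∃ Φ : PartialDiffeomorph 𝓘(𝕜, Mdl 𝕜 n) 𝓘(𝕜, Mdl 𝕜 n) (Mdl 𝕜 n) H ∞,
      (∀ v, mdlNorm N v ≤ 1 → v ∈ Φ.source) ∧ (∀ v ∈ Φ.source, Φ v = mdlExp 𝕜 n H v) :=
  hN.exp_diffeo

/-- The logarithm is a chosen preimage in the closed unit ball; injectivity of the diffeomorphism
there makes the choice unique. -/
lemma mdlLog_mdlExp (hN : IsLieNorm N) {v : Mdl 𝕜 n} (hv : mdlNorm N v ≤ 1) :
    mdlLog N (mdlExp 𝕜 n H v) = v := by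
  obtain ⟨Φ, hΦ, hΦe⟩ := hN.exists_partialDiffeomorph
  have hex : ∃ u : Alg 𝕜 n H, N u ≤ 1 ∧ lieExp u = mdlExp 𝕜 n H v := ⟨v, hv, rfl⟩
  have h1 : mdlLog N (mdlExp 𝕜 n H v) = hex.choose := dif_pos hex
  rw [h1]
  obtain ⟨h2, h3⟩ := hex.choose_spec
  have h4 : (hex.choose : Mdl 𝕜 n) ∈ Φ.source := hΦ _ h2
  have h5 := hΦ _ hv
  apply Φ.injOn h4 h5
  exact (hΦe _ h4).trans (h3.trans (hΦe _ h5).symm)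

lemma mdlExp_mem_expBall {v : Mdl 𝕜 n} (hv : mdlNorm N v ≤ 1) :
    mdlExp 𝕜 n H v ∈ expBall N := ⟨v, hv, rfl⟩

lemma mdlExp_mdlLog (hN : IsLieNorm N) {g : H} (hg : g ∈ expBall N) :
    mdlExp 𝕜 n H (mdlLog N g) = g ∧ mdlNorm N (mdlLog N g) ≤ 1 := by
  obtain ⟨v, hv, rfl⟩ := hg
  have := hN.mdlLog_mdlExp (v := v) hv
  unfold mdlExp at this ⊢
  rw [this]
  exact ⟨rfl, hv⟩

lemma contMDiffAt_mdlExp (hN : IsLieNorm N) {v : Mdl 𝕜 n} (hv : mdlNorm N v ≤ 1) :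
    ContMDiffAt 𝓘(𝕜, Mdl 𝕜 n) 𝓘(𝕜, Mdl 𝕜 n) ∞ (mdlExp 𝕜 n H) v := by
  obtain ⟨Φ, hΦ, hΦe⟩ := hN.exists_partialDiffeomorph
  have h := Φ.contMDiffOn.contMDiffAt (Φ.open_source.mem_nhds (hΦ v hv))
  refine h.congr_of_eventuallyEq ?_
  filter_upwards [Φ.open_source.mem_nhds (hΦ v hv)] with u hu using (hΦe u hu).symm

lemma continuousOn_mdlLog (hN : IsLieNorm N) : ContinuousOn (mdlLog N) (expBall N) := by
  obtain ⟨Φ, hΦ, hΦe⟩ := hN.exists_partialDiffeomorph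
  have hsub : expBall N ⊆ Φ.target := by
    intro g hg
    obtain ⟨v, hv, rfl⟩ := mem_expBall.1 hg
    rw [← hΦe v (hΦ v hv)]
    exact Φ.map_source (hΦ v hv)
  have hc : ContinuousOn Φ.invFun Φ.target := Φ.contMDiffOn_invFun.continuousOn
  refine (hc.mono hsub).congr ?_
  intro g hg
  obtain ⟨v, hv, rfl⟩ := mem_expBall.1 hg
  rw [hN.mdlLog_mdlExp hv, ← hΦe v (hΦ v hv)]
  exact (Φ.left_inv (hΦ v hv)).symm

lemma eventually_mem_expBall (hN : IsLieNorm N) {v : Mdl 𝕜 n} (hv : mdlNorm N v < 1) :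
    ∀ᶠ g in 𝓝 (mdlExp 𝕜 n H v), g ∈ expBall N := by
  obtain ⟨Φ, hΦ, hΦe⟩ := hN.exists_partialDiffeomorph
  have hvs := hΦ v hv.le
  have hU : IsOpen {u : Mdl 𝕜 n | mdlNorm N u < 1} :=
    isOpen_lt hN.continuous_mdlNorm continuous_const
  have himg := Φ.toOpenPartialHomeomorph.isOpen_image_of_subset_source hU
    (fun u (hu : mdlNorm N u < 1) => hΦ u hu.le)
  have hmem : mdlExp 𝕜 n H v ∈ Φ.toOpenPartialHomeomorph '' {u | mdlNorm N u < 1} :=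
    ⟨v, hv, hΦe v hvs⟩
  filter_upwards [himg.mem_nhds hmem]
  rintro _ ⟨u, hu, rfl⟩
  refine mem_expBall.2 ⟨u, le_of_lt hu, (hΦe u (hΦ u (le_of_lt hu))).symm⟩

lemma contMDiffAt_mdlLog (hN : IsLieNorm N) {v : Mdl 𝕜 n} (hv : mdlNorm N v < 1) :
    ContMDiffAt 𝓘(𝕜, Mdl 𝕜 n) 𝓘(𝕜, Mdl 𝕜 n) ∞ (mdlLog N) (mdlExp 𝕜 n H v) := by
  obtain ⟨Φ, hΦ, hΦe⟩ := hN.exists_partialDiffeomorph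
  have hvs := hΦ v hv.le
  have hmem : mdlExp 𝕜 n H v ∈ Φ.target := by
    rw [← hΦe v hvs]
    exact Φ.map_source hvs
  have h : ContMDiffAt 𝓘(𝕜, Mdl 𝕜 n) 𝓘(𝕜, Mdl 𝕜 n) ∞ Φ.invFun (mdlExp 𝕜 n H v) :=
    Φ.contMDiffOn_invFun.contMDiffAt (Φ.open_target.mem_nhds hmem)
  refine h.congr_of_eventuallyEq ?_
  filter_upwards [hN.eventually_mem_expBall hv] with g hg
  obtain ⟨u, hu, rfl⟩ := mem_expBall.1 hg
  rw [hN.mdlLog_mdlExp hu, ← hΦe u (hΦ u hu)]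
  exact (Φ.left_inv (hΦ u hu)).symm

lemma mdlNorm_zero_lt (hN : IsLieNorm N) : mdlNorm N 0 < 1 := by
  rw [hN.mdlNorm_zero]; exact one_pos

lemma contMDiffAt_mdlExp_comp (hN : IsLieNorm N) {V : Type*} [NormedAddCommGroup V]
    [NormedSpace 𝕜 V] {f : V → Mdl 𝕜 n} {x : V} (hf : ContDiffAt 𝕜 ∞ f x) (hx : f x = 0) :
    ContMDiffAt 𝓘(𝕜, V) 𝓘(𝕜, Mdl 𝕜 n) ∞ (fun y => mdlExp 𝕜 n H (f y)) x := by
  refine ContMDiffAt.comp (g := mdlExp 𝕜 n H) x ?_ hf.contMDiffAt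
  rw [hx]
  exact hN.contMDiffAt_mdlExp hN.mdlNorm_zero_lt.le

end IsLieNorm

end NormedLie

/-! ### First-order Taylor approximation with parameters. -/

section Taylor

variable {𝕜 : Type*} [RCLike 𝕜] {P V F : Type*} [NormedAddCommGroup P] [NormedSpace 𝕜 P]
  [NormedAddCommGroup V] [NormedSpace 𝕜 V] [NormedAddCommGroup F] [NormedSpace 𝕜 F]

/-- A `C²` family of maps vanishing at the origin is approximated by linear maps to second order,
locally uniformly in the parameter. -/
lemma ContDiffAt.exists_linear_approx {f : P × V → F} {c₀ : P} (hf : ContDiffAt 𝕜 2 f (c₀, 0))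
    (h0 : ∀ c, f (c, 0) = 0) :
    ∃ r > 0, ∃ C : ℝ, ∀ c, ‖c - c₀‖ ≤ r → ∃ Λ : V →L[𝕜] F, ‖Λ‖ ≤ C ∧
      ∀ u, ‖u‖ ≤ r → ‖f (c, u) - Λ u‖ ≤ C * ‖u‖ ^ 2 := by
  have hd1 : ContDiffAt 𝕜 1 (fderiv 𝕜 f) (c₀, 0) := hf.fderiv_right (by norm_num)
  obtain ⟨K, t, ht, hK⟩ := hd1.exists_lipschitzOnWith
  have hdiff : ∀ᶠ x in 𝓝 (c₀, (0 : V)), DifferentiableAt 𝕜 f x := by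
    filter_upwards [hf.eventually (by simp)] with x hx using hx.differentiableAt (by simp)
  obtain ⟨ε, hε, hball⟩ := Metric.mem_nhds_iff.1 (inter_mem ht hdiff)
  have hmem : ∀ c u, ‖c - c₀‖ ≤ ε / 2 → ‖u‖ ≤ ε / 2 → ((c, u) : P × V) ∈ Metric.ball (c₀, 0) ε := by
    intro c u hc hu
    rw [mem_ball_iff_norm, Prod.norm_def]
    simp only [Prod.fst_sub, Prod.snd_sub, sub_zero]
    exact max_lt (by linarith) (by linarith)
  let B := ‖fderiv 𝕜 f (c₀, 0)‖ + K * (ε / 2)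
  refine ⟨ε / 2, by positivity, max B K, fun c hc => ?_⟩
  -- The linear part is the partial derivative in the second variable at `(c, 0)`. Its norm is
  -- controlled because the derivative of a `C²` map is locally Lipschitz.
  let Λ : V →L[𝕜] F := (fderiv 𝕜 f (c, 0)).comp (ContinuousLinearMap.inr 𝕜 P V)
  have hinr : ‖ContinuousLinearMap.inr 𝕜 P V‖ ≤ 1 := ContinuousLinearMap.norm_inr_le_one 𝕜 P V
  have hc0 := hball (hmem c 0 hc (by simp; positivity))
  refine ⟨Λ, ?_, fun u hu => ?_⟩
  · refine le_trans ?_ (le_max_left _ _)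
    have h1 := hK.norm_sub_le hc0.1 (mem_of_mem_nhds ht)
    have h2 : ‖((c, 0) : P × V) - (c₀, 0)‖ = ‖c - c₀‖ := by simp [Prod.norm_def]
    rw [h2] at h1
    calc ‖Λ‖ ≤ ‖fderiv 𝕜 f (c, 0)‖ * 1 :=
          (ContinuousLinearMap.opNorm_comp_le _ _).trans (by gcongr)
      _ = ‖fderiv 𝕜 f (c₀, 0) + (fderiv 𝕜 f (c, 0) - fderiv 𝕜 f (c₀, 0))‖ := by simp
      _ ≤ ‖fderiv 𝕜 f (c₀, 0)‖ + K * ‖c - c₀‖ := (norm_add_le _ _).trans (by gcongr)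
      _ ≤ B := by simp only [B]; gcongr
  -- Mean value inequality for `f(c, ·) - Λ` on the ball of radius `‖u‖`: its derivative is at most
  -- `K‖u‖` there, which yields the quadratic error.
  · let : NormedSpace ℝ V := NormedSpace.restrictScalars ℝ 𝕜 V
    have hderiv : ∀ v ∈ Metric.closedBall (0 : V) ‖u‖,
        HasFDerivWithinAt (fun v => f (c, v) - Λ v)
          ((fderiv 𝕜 f (c, v)).comp (ContinuousLinearMap.inr 𝕜 P V) - Λ)
          (Metric.closedBall (0 : V) ‖u‖) v := by
      intro v hv
      have hv' : ‖v‖ ≤ ‖u‖ := by simpa using hv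
      have h1 := (hball (hmem c v hc (hv'.trans hu))).2.hasFDerivAt
      have h2 : HasFDerivAt (fun v : V => ((c, v) : P × V)) (ContinuousLinearMap.inr 𝕜 P V) v :=
        hasFDerivAt_prodMk_right c v
      exact ((h1.comp v h2).sub Λ.hasFDerivAt).hasFDerivWithinAt
    have hbound : ∀ v ∈ Metric.closedBall (0 : V) ‖u‖,
        ‖(fderiv 𝕜 f (c, v)).comp (ContinuousLinearMap.inr 𝕜 P V) - Λ‖ ≤ K * ‖u‖ := by
      intro v hv
      have hv' : ‖v‖ ≤ ‖u‖ := by simpa using hv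
      have h1 := hK.norm_sub_le (hball (hmem c v hc (hv'.trans hu))).1 hc0.1
      have h2 : ‖((c, v) : P × V) - (c, 0)‖ = ‖v‖ := by simp [Prod.norm_def]
      rw [h2] at h1
      rw [show (fderiv 𝕜 f (c, v)).comp (ContinuousLinearMap.inr 𝕜 P V) - Λ =
        (fderiv 𝕜 f (c, v) - fderiv 𝕜 f (c, 0)).comp (ContinuousLinearMap.inr 𝕜 P V) from rfl]
      calc _ ≤ ‖fderiv 𝕜 f (c, v) - fderiv 𝕜 f (c, 0)‖ * 1 :=
            (ContinuousLinearMap.opNorm_comp_le _ _).trans (by gcongr)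
        _ ≤ K * ‖v‖ := by simpa using h1
        _ ≤ K * ‖u‖ := by gcongr
    have h := (convex_closedBall (0 : V) ‖u‖).norm_image_sub_le_of_norm_hasFDerivWithin_le
      hderiv hbound (x := 0) (y := u) (by simp) (by simp)
    simp only [h0, map_zero, sub_zero] at h
    calc _ ≤ K * ‖u‖ * ‖u‖ := h
      _ = K * ‖u‖ ^ 2 := by ring
      _ ≤ _ := by gcongr; exact le_max_right _ _

end Taylor

/-! ### Uniform estimates for products in exponential coordinates. -/

namespace NormedLie

variable {𝕜 : Type} [RCLike 𝕜] {n : ℕ} {H : Type*} [TopologicalSpace H]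
  [ChartedSpace (Mdl 𝕜 n) H] [Group H] [LieGroup 𝓘(𝕜, Mdl 𝕜 n) ω H] {N : Alg 𝕜 n H → ℝ}

namespace IsLieNorm

lemma contMDiffAt_mdlExp_mul_mdlExp (hN : IsLieNorm N) :
    ContMDiffAt 𝓘(𝕜, Mdl 𝕜 n × Mdl 𝕜 n) 𝓘(𝕜, Mdl 𝕜 n) ∞
      (fun x => mdlExp 𝕜 n H x.1 * mdlExp 𝕜 n H x.2) (0, 0) := by
  have : LieGroup 𝓘(𝕜, Mdl 𝕜 n) ∞ H := .of_le (n := ω) le_top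
  exact (hN.contMDiffAt_mdlExp_comp contDiff_fst.contDiffAt rfl).mul
    (hN.contMDiffAt_mdlExp_comp contDiff_snd.contDiffAt rfl)

lemma contMDiffAt_mdlExp_inv_mul_mdlExp (hN : IsLieNorm N) :
    ContMDiffAt 𝓘(𝕜, Mdl 𝕜 n × Mdl 𝕜 n) 𝓘(𝕜, Mdl 𝕜 n) ∞
      (fun x => (mdlExp 𝕜 n H x.1)⁻¹ * mdlExp 𝕜 n H x.2) (0, 0) := by
  have : LieGroup 𝓘(𝕜, Mdl 𝕜 n) ∞ H := .of_le (n := ω) le_top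
  exact (hN.contMDiffAt_mdlExp_comp contDiff_fst.contDiffAt rfl).inv.mul
    (hN.contMDiffAt_mdlExp_comp contDiff_snd.contDiffAt rfl)

variable [T2Space H]

lemma mdlLog_one (hN : IsLieNorm N) : mdlLog N (1 : H) = 0 := by
  have := hN.mdlLog_mdlExp (v := 0) hN.mdlNorm_zero_lt.le
  rwa [mdlExp_zero] at this

lemma expBall_mem_nhds_one (hN : IsLieNorm N) : expBall N ∈ 𝓝 (1 : H) := by
  have := hN.eventually_mem_expBall (v := 0) hN.mdlNorm_zero_lt
  rwa [mdlExp_zero] at this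

lemma contDiffAt_mdlLog_comp (hN : IsLieNorm N) {V : Type*} [NormedAddCommGroup V]
    [NormedSpace 𝕜 V] {f : V → H} {x : V}
    (hf : ContMDiffAt 𝓘(𝕜, V) 𝓘(𝕜, Mdl 𝕜 n) ∞ f x) (hx : f x = 1) :
    ContDiffAt 𝕜 ∞ (fun y => mdlLog N (f y)) x := by
  rw [← contMDiffAt_iff_contDiffAt]
  refine ContMDiffAt.comp (g := mdlLog N) x ?_ hf
  rw [hx, ← mdlExp_zero (𝕜 := 𝕜) (n := n)]
  exact hN.contMDiffAt_mdlLog hN.mdlNorm_zero_lt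

/-- Turns a group element near `g₀` into a small vector, so that the conjugating element can serve
as the parameter in the Taylor estimate. -/
lemma eventually_mul_mdlExp (hN : IsLieNorm N) (g₀ : H) {r : ℝ} (hr : 0 < r) :
    ∀ᶠ g in 𝓝 g₀, ∃ c : Mdl 𝕜 n, ‖c‖ ≤ r ∧ g = g₀ * mdlExp 𝕜 n H c := by
  have := topologicalGroup_of_lieGroup 𝓘(𝕜, Mdl 𝕜 n) ω (G := H)
  have h1 : Tendsto (fun g : H => g₀⁻¹ * g) (𝓝 g₀) (𝓝 1) := by
    have : Continuous (fun g : H => g₀⁻¹ * g) := by fun_prop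
    simpa using this.tendsto g₀
  have h2 : ContinuousAt (mdlLog N) (1 : H) :=
    hN.continuousOn_mdlLog.continuousAt hN.expBall_mem_nhds_one
  have h3 : ∀ᶠ g in 𝓝 (1 : H), ‖mdlLog N g‖ < r := by
    refine h2.norm.eventually_lt_const ?_
    simpa [hN.mdlLog_one] using hr
  filter_upwards [h1.eventually h3, h1.eventually hN.expBall_mem_nhds_one] with g hg hg'
  exact ⟨_, hg.le, by rw [(hN.mdlExp_mdlLog hg').1]; group⟩

/-- Twisted multiplication in exponential coordinates is linear up to a quadratic error, uniformly
for conjugation by elements of a compact set. -/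
lemma exists_conj_mul_approx (hN : IsLieNorm N) {K : Set H} (hK : IsCompact K) :
    ∃ r > 0, ∃ C : ℝ, 0 < C ∧ ∀ g ∈ K, ∃ Λ : Mdl 𝕜 n × Mdl 𝕜 n →L[𝕜] Mdl 𝕜 n, ‖Λ‖ ≤ C ∧
      ∀ u : Mdl 𝕜 n × Mdl 𝕜 n, ‖u‖ ≤ r → ∃ m : Mdl 𝕜 n, mdlExp 𝕜 n H m =
        g⁻¹ * mdlExp 𝕜 n H u.1 * g * mdlExp 𝕜 n H u.2 ∧ ‖m - Λ u‖ ≤ C * ‖u‖ ^ 2 := by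
  have := topologicalGroup_of_lieGroup 𝓘(𝕜, Mdl 𝕜 n) ω (G := H)
  have : LieGroup 𝓘(𝕜, Mdl 𝕜 n) ∞ H := .of_le (n := ω) le_top
  -- The claim passes to subsets and to finite unions (minimum of the radii, maximum of the
  -- constants), so it suffices to prove it near each point of `K`.
  refine IsCompact.induction_on (p := fun K => ∃ r > 0, ∃ C : ℝ, 0 < C ∧ ∀ g ∈ K,
    ∃ Λ : Mdl 𝕜 n × Mdl 𝕜 n →L[𝕜] Mdl 𝕜 n, ‖Λ‖ ≤ C ∧
      ∀ u : Mdl 𝕜 n × Mdl 𝕜 n, ‖u‖ ≤ r → ∃ m : Mdl 𝕜 n, mdlExp 𝕜 n H m =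
        g⁻¹ * mdlExp 𝕜 n H u.1 * g * mdlExp 𝕜 n H u.2 ∧ ‖m - Λ u‖ ≤ C * ‖u‖ ^ 2) hK ?_ ?_ ?_ ?_
  · exact ⟨1, one_pos, 1, one_pos, by simp⟩
  · intro s t hst ht
    obtain ⟨r, hr, C, hC, h⟩ := ht
    exact ⟨r, hr, C, hC, fun g hg => h g (hst hg)⟩
  · intro s t hs ht
    obtain ⟨r, hr, C, hC, h⟩ := hs
    obtain ⟨r', hr', C', hC', h'⟩ := ht
    refine ⟨min r r', lt_min hr hr', max C C', lt_max_of_lt_left hC, ?_⟩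
    rintro g (hg | hg)
    · obtain ⟨Λ, hΛ, hu⟩ := h g hg
      refine ⟨Λ, hΛ.trans (le_max_left _ _), fun u hur => ?_⟩
      obtain ⟨m, hm, hm'⟩ := hu u (hur.trans (min_le_left _ _))
      exact ⟨m, hm, hm'.trans (by gcongr; exact le_max_left _ _)⟩
    · obtain ⟨Λ, hΛ, hu⟩ := h' g hg
      refine ⟨Λ, hΛ.trans (le_max_right _ _), fun u hur => ?_⟩
      obtain ⟨m, hm, hm'⟩ := hu u (hur.trans (min_le_right _ _))
      exact ⟨m, hm, hm'.trans (by gcongr; exact le_max_right _ _)⟩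
  · intro g₀ hg₀
    -- The twisted product with `g = g₀ exp c`. It equals `1` at `(c, 0)` for every `c`, so its
    -- logarithm meets the vanishing condition of `ContDiffAt.exists_linear_approx`.
    let q : Mdl 𝕜 n × (Mdl 𝕜 n × Mdl 𝕜 n) → H := fun x =>
      (g₀ * mdlExp 𝕜 n H x.1)⁻¹ * mdlExp 𝕜 n H x.2.1 * (g₀ * mdlExp 𝕜 n H x.1) *
        mdlExp 𝕜 n H x.2.2
    have hq : ContMDiffAt 𝓘(𝕜, Mdl 𝕜 n × (Mdl 𝕜 n × Mdl 𝕜 n)) 𝓘(𝕜, Mdl 𝕜 n) ∞ q (0, 0) := by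
      have h1 := hN.contMDiffAt_mdlExp_comp (contDiff_fst (𝕜 := 𝕜) (E := Mdl 𝕜 n)
        (F := Mdl 𝕜 n × Mdl 𝕜 n)).contDiffAt (x := (0, 0)) rfl
      have h2 := hN.contMDiffAt_mdlExp_comp ((contDiff_fst (𝕜 := 𝕜) (E := Mdl 𝕜 n)
        (F := Mdl 𝕜 n)).comp (contDiff_snd (𝕜 := 𝕜) (E := Mdl 𝕜 n)
        (F := Mdl 𝕜 n × Mdl 𝕜 n))).contDiffAt (x := (0, 0)) rfl
      have h3 := hN.contMDiffAt_mdlExp_comp ((contDiff_snd (𝕜 := 𝕜) (E := Mdl 𝕜 n)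
        (F := Mdl 𝕜 n)).comp (contDiff_snd (𝕜 := 𝕜) (E := Mdl 𝕜 n)
        (F := Mdl 𝕜 n × Mdl 𝕜 n))).contDiffAt (x := (0, 0)) rfl
      have h4 := (contMDiffAt_const (I := 𝓘(𝕜, Mdl 𝕜 n × (Mdl 𝕜 n × Mdl 𝕜 n)))
        (I' := 𝓘(𝕜, Mdl 𝕜 n)) (n := ∞) (c := g₀)).mul h1
      exact ((h4.inv.mul h2).mul h4).mul h3
    have hq0 : ∀ c, q (c, 0) = 1 := by
      intro c
      simp [q, mdlExp_zero]
    have hlog := hN.contDiffAt_mdlLog_comp hq (hq0 0)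
    obtain ⟨r, hr, C, h⟩ := (hlog.of_le (m := 2) ENat.LEInfty.out).exists_linear_approx
      (fun c => by simp only [hq0, hN.mdlLog_one])
    have hmem : ∀ᶠ x in 𝓝 ((0, 0) : Mdl 𝕜 n × (Mdl 𝕜 n × Mdl 𝕜 n)), q x ∈ expBall N := by
      have := hq.continuousAt
      rw [ContinuousAt, hq0] at this
      exact this.eventually hN.expBall_mem_nhds_one
    obtain ⟨ε, hε, hball⟩ := Metric.eventually_nhds_iff.1 hmem
    refine ⟨_, nhdsWithin_le_nhds (hN.eventually_mul_mdlExp g₀ (r := min r (ε / 2))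
      (by positivity)), min r (ε / 2), by positivity, max C 1, by positivity, ?_⟩
    rintro g ⟨c, hc, rfl⟩
    obtain ⟨Λ, hΛ, hu⟩ := h c (by simpa using hc.trans (min_le_left _ _))
    refine ⟨Λ, hΛ.trans (le_max_left _ _), fun u hur => ⟨mdlLog N (q (c, u)), ?_, ?_⟩⟩
    · refine (hN.mdlExp_mdlLog (hball ?_)).1
      rw [Prod.dist_eq]
      simp only [dist_zero_right]
      have h1 := hc.trans (min_le_right _ _)
      have h2 := hur.trans (min_le_right _ _)
      exact max_lt (by linarith) (by linarith)
    · exact (hu u (hur.trans (min_le_left _ _))).trans (by gcongr; exact le_max_left _ _)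

/-- A smooth map in two variables in exponential coordinates is locally Lipschitz. -/
lemma exists_lipschitz (hN : IsLieNorm N) {q : Mdl 𝕜 n × Mdl 𝕜 n → H}
    (hq : ContMDiffAt 𝓘(𝕜, Mdl 𝕜 n × Mdl 𝕜 n) 𝓘(𝕜, Mdl 𝕜 n) ∞ q (0, 0)) (hq0 : q (0, 0) = 1) :
    ∃ r > 0, ∃ L : ℝ, 0 < L ∧ (∀ x, ‖x‖ ≤ r → q x ∈ expBall N) ∧
      ∀ x y, ‖x‖ ≤ r → ‖y‖ ≤ r → ‖mdlLog N (q x) - mdlLog N (q y)‖ ≤ L * ‖x - y‖ := by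
  have hlog := hN.contDiffAt_mdlLog_comp hq hq0
  obtain ⟨K, t, ht, hK⟩ := (hlog.of_le (m := 1) (by exact_mod_cast le_top)).exists_lipschitzOnWith
  have hmem : ∀ᶠ x in 𝓝 ((0, 0) : Mdl 𝕜 n × Mdl 𝕜 n), q x ∈ expBall N := by
    have := hq.continuousAt
    rw [ContinuousAt, hq0] at this
    exact this.eventually hN.expBall_mem_nhds_one
  obtain ⟨ε, hε, hball⟩ := Metric.nhds_basis_closedBall.mem_iff.1 (inter_mem hmem ht)
  have hsub : ∀ x : Mdl 𝕜 n × Mdl 𝕜 n, ‖x‖ ≤ ε →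
      x ∈ Metric.closedBall ((0, 0) : Mdl 𝕜 n × Mdl 𝕜 n) ε := by
    intro x hx
    rw [mem_closedBall_iff_norm]
    simpa [← Prod.zero_eq_mk] using hx
  refine ⟨ε, hε, K + 1, by positivity, fun x hx => (hball (hsub x hx)).1, fun x y hx hy => ?_⟩
  have := hK.dist_le_mul _ (hball (hsub x hx)).2 _ (hball (hsub y hy)).2
  rw [dist_eq_norm, dist_eq_norm] at this
  nlinarith [norm_nonneg (x - y)]

/-- The logarithm of the quotient is Lipschitz and vanishes on the diagonal: compare `(u, v)` with
`(u, u)`. -/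
lemma exists_inv_mul_le (hN : IsLieNorm N) : ∃ r > 0, ∃ L : ℝ, 0 < L ∧
    ∀ u v : Mdl 𝕜 n, ‖u‖ ≤ r → ‖v‖ ≤ r → ∃ m : Mdl 𝕜 n,
      mdlExp 𝕜 n H m = (mdlExp 𝕜 n H u)⁻¹ * mdlExp 𝕜 n H v ∧ ‖m‖ ≤ L * ‖u - v‖ := by
  obtain ⟨r, hr, L, hL, hmem, hlip⟩ :=
    hN.exists_lipschitz hN.contMDiffAt_mdlExp_inv_mul_mdlExp (by simp [mdlExp_zero])
  refine ⟨r, hr, L, hL, fun u v hu hv => ⟨_, (hN.mdlExp_mdlLog (hmem (u, v) ?_)).1, ?_⟩⟩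
  · exact max_le hu hv
  · have := hlip (u, v) (u, u) (max_le hu hv) (max_le hu hu)
    simp only [inv_mul_cancel, hN.mdlLog_one, sub_zero] at this
    simpa [Prod.norm_def, norm_sub_rev] using this

/-- The logarithm of the product is Lipschitz and equals `u` at `(u, 0)`: compare with that point.
-/
lemma exists_mul_sub_le (hN : IsLieNorm N) : ∃ r > 0, ∃ L : ℝ, 0 < L ∧
    ∀ u v : Mdl 𝕜 n, ‖u‖ ≤ r → ‖v‖ ≤ r → ∃ m : Mdl 𝕜 n,
      mdlExp 𝕜 n H m = mdlExp 𝕜 n H u * mdlExp 𝕜 n H v ∧ ‖m - u‖ ≤ L * ‖v‖ := by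
  obtain ⟨r, hr, L, hL, hmem, hlip⟩ :=
    hN.exists_lipschitz hN.contMDiffAt_mdlExp_mul_mdlExp (by simp [mdlExp_zero])
  obtain ⟨r₀, hr₀, hball⟩ := hN.exists_ball
  refine ⟨min r r₀, by positivity, L, hL, fun u v hu hv => ?_⟩
  have hu' := hu.trans (min_le_left _ _)
  have hv' := hv.trans (min_le_left _ _)
  refine ⟨_, (hN.mdlExp_mdlLog (hmem (u, v) (max_le hu' hv'))).1, ?_⟩
  have := hlip (u, v) (u, 0) (max_le hu' hv') (max_le hu' (by simpa using hr.le))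
  simp only [mdlExp_zero, mul_one] at this
  rw [hN.mdlLog_mdlExp (hball u (hu.trans (min_le_right _ _))).le] at this
  simpa [Prod.norm_def] using this

end IsLieNorm

end NormedLie

/-! ### Comparison of the Finsler distance with the norm in exponential coordinates. -/

namespace NormedLie

variable {𝕜 : Type} [RCLike 𝕜] {n : ℕ} {H : Type*} [TopologicalSpace H]
  [ChartedSpace (Mdl 𝕜 n) H] [Group H] [LieGroup 𝓘(𝕜, Mdl 𝕜 n) ω H] {N : Alg 𝕜 n H → ℝ}

/-- The derivative at `g` of the left translation by `g⁻¹`. -/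
def toIdentity (𝕜 : Type) [RCLike 𝕜] (n : ℕ) {H : Type*} [TopologicalSpace H]
    [ChartedSpace (Mdl 𝕜 n) H] [Group H] (g : H) : Mdl 𝕜 n →L[𝕜] Mdl 𝕜 n :=
  mfderiv 𝓘(𝕜, Mdl 𝕜 n) 𝓘(𝕜, Mdl 𝕜 n) (fun x : H => g⁻¹ * x) g

lemma hasMFDerivAt_toIdentity (g : H) :
    HasMFDerivAt 𝓘(𝕜, Mdl 𝕜 n) 𝓘(𝕜, Mdl 𝕜 n) (fun x : H => g⁻¹ * x) g (toIdentity 𝕜 n g) :=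
  (mdifferentiableAt_mul_left g⁻¹ g).hasMFDerivAt

namespace IsLieNorm

variable [T2Space H]

/-- Near `exp u`, the logarithm factors as left translation to the identity, then `log` near `1`,
then `y ↦ log (exp u exp y)`. The middle derivative is the fixed map `Q`, and the last is bounded by
a Lipschitz constant independent of `u`. -/
lemma exists_mfderiv_mdlLog_le (hN : IsLieNorm N) : ∃ r > 0, ∃ M : ℝ, 0 < M ∧
    ∀ u : Mdl 𝕜 n, ‖u‖ ≤ r → ∃ A : Mdl 𝕜 n →L[𝕜] Mdl 𝕜 n,
      HasMFDerivAt 𝓘(𝕜, Mdl 𝕜 n) 𝓘(𝕜, Mdl 𝕜 n) (mdlLog N) (mdlExp 𝕜 n H u) A ∧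
      ∀ w, ‖A w‖ ≤ M * mdlNorm N (toIdentity 𝕜 n (mdlExp 𝕜 n H u) w) := by
  obtain ⟨r, hr, L, hL, hmem, hlip⟩ :=
    hN.exists_lipschitz hN.contMDiffAt_mdlExp_mul_mdlExp (by simp [mdlExp_zero])
  obtain ⟨r₀, hr₀, hball⟩ := hN.exists_ball
  obtain ⟨c, hc, hcN⟩ := hN.exists_le_mdlNorm
  have hlog1 : HasMFDerivAt 𝓘(𝕜, Mdl 𝕜 n) 𝓘(𝕜, Mdl 𝕜 n) (mdlLog N) (1 : H)
      (mfderiv 𝓘(𝕜, Mdl 𝕜 n) 𝓘(𝕜, Mdl 𝕜 n) (mdlLog N) (1 : H)) := by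
    have := hN.contMDiffAt_mdlLog hN.mdlNorm_zero_lt
    rw [mdlExp_zero] at this
    exact (this.mdifferentiableAt (by simp)).hasMFDerivAt
  let Q : Mdl 𝕜 n →L[𝕜] Mdl 𝕜 n :=
    mfderiv 𝓘(𝕜, Mdl 𝕜 n) 𝓘(𝕜, Mdl 𝕜 n) (mdlLog N) (1 : H)
  refine ⟨min r r₀, by positivity, L * (‖Q‖ + 1) * c, by positivity, fun u hu => ?_⟩
  have hur := hu.trans (min_le_left _ _)
  have hu1 : mdlNorm N u < 1 := hball u (hu.trans (min_le_right _ _))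
  let A : Mdl 𝕜 n →L[𝕜] Mdl 𝕜 n :=
    mfderiv 𝓘(𝕜, Mdl 𝕜 n) 𝓘(𝕜, Mdl 𝕜 n) (mdlLog N) (mdlExp 𝕜 n H u)
  have hA : HasMFDerivAt 𝓘(𝕜, Mdl 𝕜 n) 𝓘(𝕜, Mdl 𝕜 n) (mdlLog N) (mdlExp 𝕜 n H u) A :=
    ((hN.contMDiffAt_mdlLog hu1).mdifferentiableAt (by simp)).hasMFDerivAt
  refine ⟨A, hA, fun w => ?_⟩
  let f : Mdl 𝕜 n → Mdl 𝕜 n := fun y => mdlLog N (mdlExp 𝕜 n H u * mdlExp 𝕜 n H y)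
  have hf : DifferentiableAt 𝕜 f 0 := by
    rw [← mdifferentiableAt_iff_differentiableAt]
    have h1 := (hN.contMDiffAt_mdlExp hN.mdlNorm_zero_lt.le).mdifferentiableAt (by simp)
    have h2 := mdifferentiableAt_mul_left (𝕜 := 𝕜) (n := n) (mdlExp 𝕜 n H u) (mdlExp 𝕜 n H 0)
    have h3 : MDifferentiableAt 𝓘(𝕜, Mdl 𝕜 n) 𝓘(𝕜, Mdl 𝕜 n) (mdlLog N)
        (mdlExp 𝕜 n H u * mdlExp 𝕜 n H 0) := by
      rw [mdlExp_zero, mul_one]; exact hA.mdifferentiableAt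
    exact MDifferentiableAt.comp (g := mdlLog N)
      (f := (fun y => mdlExp 𝕜 n H u * y) ∘ mdlExp 𝕜 n H) _ h3 (h2.comp _ h1)
  have hfL : ‖fderiv 𝕜 f 0‖ ≤ L := by
    refine norm_fderiv_le_of_lip' 𝕜 hL.le ?_
    filter_upwards [Metric.closedBall_mem_nhds (0 : Mdl 𝕜 n) hr] with y hy
    have hy' : ‖y‖ ≤ r := by simpa using hy
    have := hlip (u, y) (u, 0) (max_le hur hy') (max_le hur (by simpa using hr.le))
    simpa [Prod.norm_def, f] using this
  have hcomp : HasMFDerivAt 𝓘(𝕜, Mdl 𝕜 n) 𝓘(𝕜, Mdl 𝕜 n)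
      (f ∘ mdlLog N ∘ fun x : H => (mdlExp 𝕜 n H u)⁻¹ * x) (mdlExp 𝕜 n H u)
      ((fderiv 𝕜 f 0).comp (Q.comp (toIdentity 𝕜 n (mdlExp 𝕜 n H u)))) := by
    have h1 := hasMFDerivAt_toIdentity (𝕜 := 𝕜) (n := n) (mdlExp 𝕜 n H u)
    have h2 : HasMFDerivAt 𝓘(𝕜, Mdl 𝕜 n) 𝓘(𝕜, Mdl 𝕜 n) (mdlLog N)
        ((mdlExp 𝕜 n H u)⁻¹ * mdlExp 𝕜 n H u) Q := by
      rw [inv_mul_cancel]; exact hlog1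
    have h3 : HasMFDerivAt 𝓘(𝕜, Mdl 𝕜 n) 𝓘(𝕜, Mdl 𝕜 n) f
        (mdlLog N ((mdlExp 𝕜 n H u)⁻¹ * mdlExp 𝕜 n H u)) (fderiv 𝕜 f 0) := by
      rw [inv_mul_cancel, hN.mdlLog_one]; exact hf.hasFDerivAt.hasMFDerivAt
    exact HasMFDerivAt.comp (g := f) _ h3 (HasMFDerivAt.comp (g := mdlLog N) _ h2 h1)
  have heq : mdlLog N =ᶠ[𝓝 (mdlExp 𝕜 n H u)]
      f ∘ mdlLog N ∘ fun x : H => (mdlExp 𝕜 n H u)⁻¹ * x := by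
    have hcont : Tendsto (fun x : H => (mdlExp 𝕜 n H u)⁻¹ * x) (𝓝 (mdlExp 𝕜 n H u)) (𝓝 1) := by
      have := (hasMFDerivAt_toIdentity (𝕜 := 𝕜) (n := n) (mdlExp 𝕜 n H u)).continuousAt
      rwa [ContinuousAt, inv_mul_cancel] at this
    filter_upwards [hcont.eventually hN.expBall_mem_nhds_one] with x hx
    simp only [Function.comp_apply, f, (hN.mdlExp_mdlLog hx).1, mul_inv_cancel_left]
  have hAeq := hasMFDerivAt_unique hA (hcomp.congr_of_eventuallyEq heq)
  have hAw : A w = (fderiv 𝕜 f 0) (Q (toIdentity 𝕜 n (mdlExp 𝕜 n H u) w)) :=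
    congrArg (fun B : Mdl 𝕜 n →L[𝕜] Mdl 𝕜 n => B w) hAeq
  rw [hAw]
  set z := toIdentity 𝕜 n (mdlExp 𝕜 n H u) w
  calc ‖fderiv 𝕜 f 0 (Q z)‖ ≤ ‖fderiv 𝕜 f 0‖ * ‖Q z‖ := ContinuousLinearMap.le_opNorm _ _
    _ ≤ L * ((‖Q‖ + 1) * (c * mdlNorm N z)) := by
      gcongr
      refine (Q.le_opNorm z).trans ?_
      have := hN.mdlNorm_nonneg z
      gcongr
      · linarith
      · exact hcN z
    _ = _ := by ring

/-- The reverse bound: `exp(u)⁻¹ exp y` is `exp` of `f y = log (exp(u)⁻¹ exp y)`, and `f` is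
Lipschitz uniformly in `u` and vanishes at `y = u`. -/
lemma exists_mfderiv_mdlExp_le (hN : IsLieNorm N) : ∃ r > 0, ∃ M : ℝ, 0 < M ∧
    ∀ u : Mdl 𝕜 n, ‖u‖ ≤ r → ∃ A : Mdl 𝕜 n →L[𝕜] Mdl 𝕜 n,
      HasMFDerivAt 𝓘(𝕜, Mdl 𝕜 n) 𝓘(𝕜, Mdl 𝕜 n) (mdlExp 𝕜 n H) u A ∧
      ∀ w, mdlNorm N (toIdentity 𝕜 n (mdlExp 𝕜 n H u) (A w)) ≤ M * ‖w‖ := by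
  obtain ⟨r, hr, L, hL, hmem, hlip⟩ :=
    hN.exists_lipschitz hN.contMDiffAt_mdlExp_inv_mul_mdlExp (by simp [mdlExp_zero])
  obtain ⟨r₀, hr₀, hball⟩ := hN.exists_ball
  obtain ⟨c, hc, hcN⟩ := hN.exists_mdlNorm_le
  let Q : Mdl 𝕜 n →L[𝕜] Mdl 𝕜 n :=
    mfderiv 𝓘(𝕜, Mdl 𝕜 n) 𝓘(𝕜, Mdl 𝕜 n) (mdlExp 𝕜 n H) 0
  have hQ : HasMFDerivAt 𝓘(𝕜, Mdl 𝕜 n) 𝓘(𝕜, Mdl 𝕜 n) (mdlExp 𝕜 n H) 0 Q :=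
    ((hN.contMDiffAt_mdlExp hN.mdlNorm_zero_lt.le).mdifferentiableAt (by simp)).hasMFDerivAt
  have hlog1 : MDifferentiableAt 𝓘(𝕜, Mdl 𝕜 n) 𝓘(𝕜, Mdl 𝕜 n) (mdlLog N) (1 : H) := by
    have := hN.contMDiffAt_mdlLog hN.mdlNorm_zero_lt
    rw [mdlExp_zero] at this
    exact this.mdifferentiableAt (by simp)
  -- Half the radius, so that a whole neighbourhood of `u` stays where the Lipschitz bound holds.
  refine ⟨min (r / 2) r₀, by positivity, c * ((‖Q‖ + 1) * L), by positivity, fun u hu => ?_⟩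
  have hur := hu.trans (min_le_left _ _)
  have hu1 : mdlNorm N u < 1 := hball u (hu.trans (min_le_right _ _))
  let A : Mdl 𝕜 n →L[𝕜] Mdl 𝕜 n :=
    mfderiv 𝓘(𝕜, Mdl 𝕜 n) 𝓘(𝕜, Mdl 𝕜 n) (mdlExp 𝕜 n H) u
  have hA : HasMFDerivAt 𝓘(𝕜, Mdl 𝕜 n) 𝓘(𝕜, Mdl 𝕜 n) (mdlExp 𝕜 n H) u A :=
    ((hN.contMDiffAt_mdlExp hu1.le).mdifferentiableAt (by simp)).hasMFDerivAt
  refine ⟨A, hA, fun w => ?_⟩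
  let q : Mdl 𝕜 n → H := fun y => (mdlExp 𝕜 n H u)⁻¹ * mdlExp 𝕜 n H y
  let f : Mdl 𝕜 n → Mdl 𝕜 n := fun y => mdlLog N (q y)
  have hq : HasMFDerivAt 𝓘(𝕜, Mdl 𝕜 n) 𝓘(𝕜, Mdl 𝕜 n) q u
      ((toIdentity 𝕜 n (mdlExp 𝕜 n H u)).comp A) :=
    (hasMFDerivAt_toIdentity (𝕜 := 𝕜) (n := n) (mdlExp 𝕜 n H u)).comp u hA
  have hqu : q u = 1 := inv_mul_cancel _
  have hf : DifferentiableAt 𝕜 f u := by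
    rw [← mdifferentiableAt_iff_differentiableAt]
    rw [← hqu] at hlog1
    exact hlog1.comp u hq.mdifferentiableAt
  have hfu : f u = 0 := by simp only [f, hqu, hN.mdlLog_one]
  have hnear : ∀ᶠ y in 𝓝 u, ‖y‖ ≤ r := by
    have : ‖u‖ < r := by linarith
    filter_upwards [continuous_norm.continuousAt.eventually_lt_const this] with y hy using hy.le
  have hfL : ‖fderiv 𝕜 f u‖ ≤ L := by
    refine norm_fderiv_le_of_lip' 𝕜 hL.le ?_
    filter_upwards [hnear] with y hy
    have hur' : ‖u‖ ≤ r := by linarith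
    have := hlip (u, y) (u, u) (max_le hur' hy) (max_le hur' hur')
    simpa [Prod.norm_def, f, q] using this
  have hcomp : HasMFDerivAt 𝓘(𝕜, Mdl 𝕜 n) 𝓘(𝕜, Mdl 𝕜 n) (mdlExp 𝕜 n H ∘ f) u
      (Q.comp (fderiv 𝕜 f u)) := by
    rw [← hfu] at hQ
    exact HasMFDerivAt.comp (g := mdlExp 𝕜 n H) (f := f) u hQ hf.hasFDerivAt.hasMFDerivAt
  have heq : q =ᶠ[𝓝 u] mdlExp 𝕜 n H ∘ f := by
    filter_upwards [hnear] with y hy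
    have hur' : ‖u‖ ≤ r := by linarith
    exact (hN.mdlExp_mdlLog (hmem (u, y) (max_le hur' hy))).1.symm
  have hAeq := hasMFDerivAt_unique hq (hcomp.congr_of_eventuallyEq heq)
  have hAw : toIdentity 𝕜 n (mdlExp 𝕜 n H u) (A w) = Q (fderiv 𝕜 f u w) :=
    congrArg (fun B : Mdl 𝕜 n →L[𝕜] Mdl 𝕜 n => B w) hAeq
  rw [hAw]
  calc mdlNorm N (Q (fderiv 𝕜 f u w)) ≤ c * ‖Q (fderiv 𝕜 f u w)‖ := hcN _
    _ ≤ c * ((‖Q‖ + 1) * (L * ‖w‖)) := by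
      gcongr
      refine (Q.le_opNorm _).trans ?_
      gcongr
      · linarith
      · exact ((fderiv 𝕜 f u).le_opNorm w).trans (by gcongr)
    _ = _ := by ring

end IsLieNorm

end NormedLie

namespace NormedLie

variable {𝕜 : Type} [RCLike 𝕜] {n : ℕ} {H : Type*} [TopologicalSpace H]
  [ChartedSpace (Mdl 𝕜 n) H] [Group H] {N : Alg 𝕜 n H → ℝ}

lemma leftFinsler_enorm (g : H) (w : Mdl 𝕜 n) :
    (leftFinsler N g).enorm w = ENNReal.ofReal (mdlNorm N (toIdentity 𝕜 n g w)) := rfl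

lemma IsLieNorm.enormSMulClass (hN : IsLieNorm N) :
    letI := leftFinsler N
    ∀ g : H, ENormSMulClass ℝ (TangentSpace 𝓘(ℝ, Mdl 𝕜 n) g) := by
  intro g
  let := leftFinsler N
  refine ⟨fun r w => ?_⟩
  let w' : Mdl 𝕜 n := w
  have h1 : toIdentity 𝕜 n g (r • w') = r • toIdentity 𝕜 n g w' :=
    ((toIdentity 𝕜 n g).restrictScalars ℝ).map_smul r w'
  change ENNReal.ofReal (mdlNorm N (toIdentity 𝕜 n g (r • w'))) =
    ‖r‖ₑ * ENNReal.ofReal (mdlNorm N (toIdentity 𝕜 n g w'))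
  rw [h1, hN.mdlNorm_smul, ENNReal.ofReal_mul (abs_nonneg r), ← Real.norm_eq_abs, ofReal_norm]

namespace IsLieNorm

variable [T2Space H] [LieGroup 𝓘(𝕜, Mdl 𝕜 n) ω H]

/-- The distance of `x` and `x exp v` is small when `v` is small. -/
lemma exists_finslerEDist_mul_le (hN : IsLieNorm N) : ∃ r > 0, ∃ M : ℝ, 0 < M ∧
    ∀ (x : H) (v : Mdl 𝕜 n), ‖v‖ ≤ r →
      finslerEDist N x (x * mdlExp 𝕜 n H v) ≤ ENNReal.ofReal (M * ‖v‖) := by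
  obtain ⟨r, hr, M, hM, h⟩ := hN.exists_mfderiv_mdlExp_le
  obtain ⟨r₀, hr₀, hball⟩ := hN.exists_ball
  refine ⟨min r r₀, by positivity, M, hM, fun x v hv => ?_⟩
  let := leftFinsler N
  have := hN.enormSMulClass
  have hnorm : ∀ t ∈ Icc (0 : ℝ) 1, ‖t • v‖ ≤ ‖v‖ := by
    intro t ht
    rw [norm_smul, Real.norm_of_nonneg ht.1]
    exact mul_le_of_le_one_left (norm_nonneg v) ht.2
  -- The length of this path bounds the distance.
  let γ : ℝ → H := fun t => x * mdlExp 𝕜 n H (t • v)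
  have hγ : ContMDiffOn 𝓘(ℝ, ℝ) 𝓘(ℝ, Mdl 𝕜 n) 1 γ (Icc 0 1) := by
    intro t ht
    have h1 : ContMDiffWithinAt 𝓘(ℝ, ℝ) 𝓘(ℝ, Mdl 𝕜 n) 1 (fun t : ℝ => t • v) (Icc 0 1) t :=
      (contDiff_id.smul contDiff_const).contMDiff.contMDiffAt.contMDiffWithinAt
    have h2 : ContMDiffWithinAt 𝓘(ℝ, Mdl 𝕜 n) 𝓘(ℝ, Mdl 𝕜 n) 1 (mdlExp 𝕜 n H) univ (t • v) := by
      refine ContMDiffWithinAt.restrictScalars_real (𝕜 := 𝕜) ?_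
      refine ((hN.contMDiffAt_mdlExp (hball _ ?_).le).of_le ENat.LEInfty.out).contMDiffWithinAt
      exact (hnorm t ht).trans (hv.trans (min_le_right _ _))
    have h3 : ContMDiffWithinAt 𝓘(ℝ, Mdl 𝕜 n) 𝓘(ℝ, Mdl 𝕜 n) 1 (fun y : H => x * y) univ
        (mdlExp 𝕜 n H (t • v)) := by
      refine ContMDiffWithinAt.restrictScalars_real (𝕜 := 𝕜) ?_
      exact ((contMDiff_mul_left (I := 𝓘(𝕜, Mdl 𝕜 n)) (n := ω)).of_le le_top).contMDiffAt
        |>.contMDiffWithinAt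
    exact ContMDiffWithinAt.comp t h3 (ContMDiffWithinAt.comp t h2 h1 (mapsTo_univ _ _))
      (mapsTo_univ _ _)
  have hle := Manifold.riemannianEDist_le_pathELength hγ (x := x) (y := x * mdlExp 𝕜 n H v)
    (by simp [γ, mdlExp_zero]) (by simp [γ]) zero_le_one
  refine hle.trans ?_
  rw [Manifold.pathELength_eq_lintegral_mfderiv_Icc]
  have hbound : ∀ t ∈ Icc (0 : ℝ) 1,
      ‖mfderiv 𝓘(ℝ, ℝ) 𝓘(ℝ, Mdl 𝕜 n) γ t 1‖ₑ ≤ ENNReal.ofReal (M * ‖v‖) := by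
    intro t ht
    obtain ⟨A, hA, hAN⟩ := h (t • v) ((hnorm t ht).trans (hv.trans (min_le_left _ _)))
    let D : Mdl 𝕜 n →L[𝕜] Mdl 𝕜 n := mfderiv 𝓘(𝕜, Mdl 𝕜 n) 𝓘(𝕜, Mdl 𝕜 n)
      (fun y : H => x * y) (mdlExp 𝕜 n H (t • v))
    have hD : HasMFDerivAt 𝓘(𝕜, Mdl 𝕜 n) 𝓘(𝕜, Mdl 𝕜 n)
      (fun y : H => x * y) (mdlExp 𝕜 n H (t • v)) D :=
      (mdifferentiableAt_mul_left x _).hasMFDerivAt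
    have hder : HasMFDerivAt 𝓘(ℝ, ℝ) 𝓘(ℝ, Mdl 𝕜 n) γ t
        (((D.comp A).restrictScalars ℝ).comp (ContinuousLinearMap.toSpanSingleton ℝ v)) := by
      have h1 : HasMFDerivAt 𝓘(ℝ, ℝ) 𝓘(ℝ, Mdl 𝕜 n) (fun t : ℝ => t • v) t
          (ContinuousLinearMap.toSpanSingleton ℝ v) :=
        (ContinuousLinearMap.toSpanSingleton ℝ v).hasMFDerivAt
      have h2 := HasMFDerivAt.restrictScalars_real (HasMFDerivAt.comp (t • v) hD hA)
      exact HasMFDerivAt.comp (g := (fun y => x * y) ∘ mdlExp 𝕜 n H) t h2 h1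
    have hval : (mfderiv 𝓘(ℝ, ℝ) 𝓘(ℝ, Mdl 𝕜 n) γ t : ℝ →L[ℝ] Mdl 𝕜 n) 1 = D (A v) := by
      rw [hder.mfderiv]
      change D (A ((1 : ℝ) • v)) = D (A v)
      rw [one_smul]
    -- Left invariance: the speed does not depend on `x`.
    have htr : toIdentity 𝕜 n (γ t) (D (A v)) = toIdentity 𝕜 n (mdlExp 𝕜 n H (t • v)) (A v) := by
      have h1 : HasMFDerivAt 𝓘(𝕜, Mdl 𝕜 n) 𝓘(𝕜, Mdl 𝕜 n)
          ((fun y : H => (γ t)⁻¹ * y) ∘ fun y : H => x * y) (mdlExp 𝕜 n H (t • v))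
          ((toIdentity 𝕜 n (γ t)).comp D) :=
        HasMFDerivAt.comp _ (hasMFDerivAt_toIdentity (γ t)) hD
      have h2 : ((fun y : H => (γ t)⁻¹ * y) ∘ fun y : H => x * y) =
          fun y : H => (mdlExp 𝕜 n H (t • v))⁻¹ * y := by
        ext y
        simp [γ, mul_assoc]
      rw [h2] at h1
      have h3 := hasMFDerivAt_unique h1 (hasMFDerivAt_toIdentity (mdlExp 𝕜 n H (t • v)))
      exact congrArg (fun B : Mdl 𝕜 n →L[𝕜] Mdl 𝕜 n => B (A v)) h3
    change (leftFinsler N (γ t)).enorm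
      ((mfderiv 𝓘(ℝ, ℝ) 𝓘(ℝ, Mdl 𝕜 n) γ t : ℝ →L[ℝ] Mdl 𝕜 n) 1) ≤ _
    rw [hval, leftFinsler_enorm, htr]
    exact ENNReal.ofReal_le_ofReal (hAN v)
  calc _ ≤ ∫⁻ _ in Icc (0 : ℝ) 1, ENNReal.ofReal (M * ‖v‖) :=
        setLIntegral_mono' measurableSet_Icc hbound
    _ = _ := by simp

/-- Points close to the identity are exponentials of small vectors. -/
lemma exists_of_finslerEDist_one_le (hN : IsLieNorm N) {δ : ℝ} (hδ : 0 < δ) : ∃ C : ℝ, 0 < C ∧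
    ∀ g : H, finslerEDist N g 1 ≤ ENNReal.ofReal C →
      ∃ v : Mdl 𝕜 n, ‖v‖ ≤ δ ∧ mdlExp 𝕜 n H v = g := by
  obtain ⟨r, hr, M, hM, h⟩ := hN.exists_mfderiv_mdlLog_le
  obtain ⟨r₀, hr₀, hball⟩ := hN.exists_ball
  wlog hδr : δ ≤ min r r₀ generalizing δ
  · obtain ⟨C, hC, hv⟩ := this (δ := min δ (min r r₀)) (by positivity) (min_le_right _ _)
    refine ⟨C, hC, fun g hg => ?_⟩
    obtain ⟨v, hv, hvg⟩ := hv g hg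
    exact ⟨v, hv.trans (min_le_left _ _), hvg⟩
  have hδr1 := hδr.trans (min_le_left _ _)
  have hδr2 := hδr.trans (min_le_right _ _)
  -- The factor `2` makes the distance strictly less than `δ / M`, so some path is shorter than
  -- that.
  refine ⟨δ / (2 * M), by positivity, fun g hg => ?_⟩
  let := leftFinsler N
  have := hN.enormSMulClass
  have hlt : Manifold.riemannianEDist 𝓘(ℝ, Mdl 𝕜 n) (1 : H) g < ENNReal.ofReal (δ / M) := by
    rw [Manifold.riemannianEDist_comm]
    refine lt_of_le_of_lt hg ((ENNReal.ofReal_lt_ofReal_iff (by positivity)).2 ?_)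
    gcongr
    linarith
  obtain ⟨γ, hγ0, hγ1, hγ, hlen, -⟩ :=
    Manifold.exists_lt_locally_constant_of_riemannianEDist_lt hlt zero_lt_one
  -- Continuity argument: the path starts in the closed set `S`. As long as it stays in `S` its
  -- logarithm is defined and has norm at most `M` times the length, hence strictly below `δ`, so
  -- the path cannot leave `S`.
  let S : Set H := mdlExp 𝕜 n H '' Metric.closedBall 0 δ
  have hScl : IsClosed S := by
    refine ((isCompact_closedBall (0 : Mdl 𝕜 n) δ).image_of_continuousOn ?_).isClosed
    intro u hu
    have hu' : ‖u‖ ≤ δ := by simpa using hu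
    exact (hN.contMDiffAt_mdlExp (hball u (hu'.trans hδr2)).le).continuousAt.continuousWithinAt
  suffices Icc 0 1 ⊆ γ ⁻¹' S by
    obtain ⟨v, hv, hvg⟩ := this (right_mem_Icc.2 zero_le_one)
    exact ⟨v, by simpa using hv, by rw [hvg, hγ1]⟩
  have hcl : IsClosed (γ ⁻¹' S ∩ Icc 0 1) := (hScl.preimage hγ.continuous).inter isClosed_Icc
  refine hcl.Icc_subset_of_forall_mem_nhdsGT_of_Icc_subset
    ⟨0, by simpa using hδ.le, by rw [mdlExp_zero, hγ0]⟩ ?_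
  rintro t₁ ⟨ht0, ht1⟩ hsub
  have hlift : ∀ t ∈ Icc 0 t₁, ∃ u : Mdl 𝕜 n, ‖u‖ ≤ δ ∧ mdlExp 𝕜 n H u = γ t := by
    intro t ht
    obtain ⟨u, hu, hu'⟩ := hsub ht
    exact ⟨u, by simpa using hu, hu'⟩
  have hlogC : ContMDiffOn 𝓘(ℝ, ℝ) 𝓘(ℝ, Mdl 𝕜 n) 1 (mdlLog N ∘ γ) (Icc 0 t₁) := by
    intro t ht
    obtain ⟨u, hu, hut⟩ := hlift t ht
    have h2 : ContMDiffWithinAt 𝓘(ℝ, Mdl 𝕜 n) 𝓘(ℝ, Mdl 𝕜 n) 1 (mdlLog N) univ (γ t) := by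
      refine ContMDiffWithinAt.restrictScalars_real (𝕜 := 𝕜) ?_
      rw [← hut]
      exact ((hN.contMDiffAt_mdlLog (hball u (hu.trans hδr2))).of_le
        ENat.LEInfty.out).contMDiffWithinAt
    exact ContMDiffWithinAt.comp t h2 (hγ.contMDiffAt.contMDiffWithinAt) (mapsTo_univ _ _)
  have hsmall : ‖mdlLog N (γ t₁)‖ₑ < ENNReal.ofReal δ := by
    -- Derivatives within `[0, t₁]` are unique only for `t₁ > 0`.
    rcases ht0.eq_or_lt with rfl | ht0'
    · simpa [hγ0, hN.mdlLog_one] using hδ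
    have hpt : ∀ t ∈ Icc 0 t₁, ‖derivWithin (mdlLog N ∘ γ) (Icc 0 t₁) t‖ₑ ≤
        ENNReal.ofReal M * ‖mfderivWithin 𝓘(ℝ, ℝ) 𝓘(ℝ, Mdl 𝕜 n) γ (Icc 0 t₁) t 1‖ₑ := by
      intro t ht
      obtain ⟨u, hu, hut⟩ := hlift t ht
      obtain ⟨A, hA, hAN⟩ := h u (hu.trans hδr1)
      rw [hut] at hA hAN
      let w : ℝ →L[ℝ] Mdl 𝕜 n := mfderivWithin 𝓘(ℝ, ℝ) 𝓘(ℝ, Mdl 𝕜 n) γ (Icc 0 t₁) t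
      have hw : HasMFDerivWithinAt 𝓘(ℝ, ℝ) 𝓘(ℝ, Mdl 𝕜 n) γ (Icc 0 t₁) t w :=
        ((hγ.mdifferentiable one_ne_zero) t).mdifferentiableWithinAt.hasMFDerivWithinAt
      have hcomp := HasMFDerivAt.comp_hasMFDerivWithinAt t
        (HasMFDerivAt.restrictScalars_real hA) hw
      have hF : HasFDerivWithinAt (mdlLog N ∘ γ) ((A.restrictScalars ℝ).comp w) (Icc 0 t₁) t :=
        hcomp.hasFDerivWithinAt
      have hder : derivWithin (mdlLog N ∘ γ) (Icc 0 t₁) t = A (w 1) :=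
        hF.hasDerivWithinAt.derivWithin (uniqueDiffOn_Icc ht0' t ht)
      rw [hder]
      change _ ≤ _ * (leftFinsler N (γ t)).enorm (w 1)
      rw [leftFinsler_enorm, ← ENNReal.ofReal_mul hM.le, ← ofReal_norm]
      exact ENNReal.ofReal_le_ofReal (hAN (w 1))
    have h0 : (mdlLog N ∘ γ) 0 = 0 := by simp [hγ0, hN.mdlLog_one]
    calc ‖mdlLog N (γ t₁)‖ₑ = ‖(mdlLog N ∘ γ) t₁ - (mdlLog N ∘ γ) 0‖ₑ := by rw [h0, sub_zero]; rfl
      _ ≤ ∫⁻ t in Icc 0 t₁, ‖derivWithin (mdlLog N ∘ γ) (Icc 0 t₁) t‖ₑ :=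
        enorm_sub_le_lintegral_derivWithin_Icc_of_contDiffOn_Icc
          (contMDiffOn_iff_contDiffOn.1 hlogC) ht0
      _ ≤ ∫⁻ t in Icc 0 t₁, ENNReal.ofReal M *
            ‖mfderivWithin 𝓘(ℝ, ℝ) 𝓘(ℝ, Mdl 𝕜 n) γ (Icc 0 t₁) t 1‖ₑ :=
        setLIntegral_mono' measurableSet_Icc hpt
      _ = ENNReal.ofReal M * Manifold.pathELength 𝓘(ℝ, Mdl 𝕜 n) γ 0 t₁ := by
        rw [lintegral_const_mul' _ _ ENNReal.ofReal_ne_top,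
          Manifold.pathELength_eq_lintegral_mfderivWithin_Icc]
      _ ≤ ENNReal.ofReal M * Manifold.pathELength 𝓘(ℝ, Mdl 𝕜 n) γ 0 1 := by
        gcongr
      _ < ENNReal.ofReal M * ENNReal.ofReal (δ / M) := by
        refine (ENNReal.mul_lt_mul_iff_right ?_ ENNReal.ofReal_ne_top).2 hlen
        simpa using hM
      _ = ENNReal.ofReal δ := by
        rw [← ENNReal.ofReal_mul hM.le]
        congr 1
        field_simp
  obtain ⟨u, hu, hut⟩ := hlift t₁ (right_mem_Icc.2 ht0)
  have hu1 := hball u (hu.trans hδr2)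
  have hsmall' : ‖mdlLog N (γ t₁)‖ < δ := by
    rw [← ofReal_norm] at hsmall
    exact (ENNReal.ofReal_lt_ofReal_iff hδ).1 hsmall
  have hcont : ContinuousAt (mdlLog N) (γ t₁) := by
    rw [← hut]; exact (hN.contMDiffAt_mdlLog hu1).continuousAt
  have hmem : ∀ᶠ x in 𝓝 (γ t₁), x ∈ expBall N := by
    rw [← hut]; exact hN.eventually_mem_expBall hu1
  have hev : ∀ᶠ x in 𝓝 (γ t₁), x ∈ S := by
    filter_upwards [hmem, hcont.norm.eventually_lt_const hsmall'] with x hx hx'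
    exact ⟨mdlLog N x, by simpa using hx'.le, (hN.mdlExp_mdlLog hx).1⟩
  exact nhdsWithin_le_nhds (hγ.continuous.continuousAt.eventually hev)

end IsLieNorm

end NormedLie

/-! ### Integration against a vector measure with a density. -/

namespace MeasureTheory

variable {X : Type*} [MeasurableSpace X] {𝕜 : Type*} [RCLike 𝕜] {V : Type*}
  [NormedAddCommGroup V] [NormedSpace 𝕜 V] [NormedSpace ℝ V] [IsScalarTower ℝ 𝕜 V]

/-- `ρ h` is `‖ρ‖ h` times the phase `ρ / ‖ρ‖`, which is measurable and of modulus at most `1`. -/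
lemma Integrable.smul_of_withDensity {ν : Measure X} {ρ : X → 𝕜} (hρ : Integrable ρ ν) {h : X → V}
    (hh : Integrable h (ν.withDensity fun x => ‖ρ x‖ₑ)) : Integrable (fun x => ρ x • h x) ν := by
  rw [integrable_withDensity_iff_integrable_smul₀' hρ.aestronglyMeasurable.enorm
    (ae_of_all _ fun x => enorm_lt_top)] at hh
  have heq : (fun x => ρ x • h x) =
      fun x => (((‖ρ x‖⁻¹ : ℝ) : 𝕜) * ρ x) • (‖ρ x‖ₑ.toReal • h x) := by
    ext x
    rcases eq_or_ne (ρ x) 0 with h0 | h0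
    · simp [h0]
    have h1 : (‖ρ x‖ : 𝕜) ≠ 0 := by simpa using h0
    rw [toReal_enorm, ← algebraMap_smul 𝕜 ‖ρ x‖ (h x), smul_smul, RCLike.algebraMap_eq_ofReal]
    congr 1
    push_cast
    field_simp
  refine hh.mono ?_ (ae_of_all _ fun x => ?_)
  · rw [heq]
    refine AEStronglyMeasurable.smul ?_ hh.aestronglyMeasurable
    exact (RCLike.continuous_ofReal.comp_aestronglyMeasurable
      hρ.aestronglyMeasurable.norm.inv₀).mul hρ.aestronglyMeasurable
  · simp [norm_smul]

lemma norm_integral_smul_sub_le {ν : Measure X} {ρ : X → 𝕜} (hρ : Integrable ρ ν) {f g : X → V}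
    (hf : Integrable f (ν.withDensity fun x => ‖ρ x‖ₑ))
    (hg : Integrable g (ν.withDensity fun x => ‖ρ x‖ₑ)) :
    ‖∫ x, ρ x • f x ∂ν - ∫ x, ρ x • g x ∂ν‖ ≤
      ∫ x, ‖f x - g x‖ ∂(ν.withDensity fun x => ‖ρ x‖ₑ) := by
  rw [← integral_sub (hρ.smul_of_withDensity hf) (hρ.smul_of_withDensity hg),
    integral_withDensity_eq_integral_toReal_smul₀ hρ.aestronglyMeasurable.enorm
    (ae_of_all _ fun x => enorm_lt_top)]
  refine (norm_integral_le_integral_norm _).trans_eq (integral_congr_ae (ae_of_all _ fun x => ?_))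
  simp [← smul_sub, norm_smul]

/-- Integration against the vector measure with density `ρ`. -/
lemma integral_withDensityᵥ [CompleteSpace V] {ν : Measure X} {ρ : X → 𝕜} (hρ : Integrable ρ ν)
    {h : X → V} (hh : Integrable h (ν.withDensity fun x => ‖ρ x‖ₑ)) :
    (ν.withDensityᵥ ρ).integral h (ContinuousLinearMap.lsmul ℝ 𝕜 : 𝕜 →L[ℝ] V →L[ℝ] V).flip =
      ∫ x, ρ x • h x ∂ν := by
  have hvar : (ν.withDensityᵥ ρ).variation = ν.withDensity fun x => ‖ρ x‖ₑ :=
    Measure.variation_withDensityᵥ hρ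
  have : IsFiniteMeasure (ν.withDensity fun x => ‖ρ x‖ₑ) :=
    isFiniteMeasure_withDensity hρ.2.ne
  have : IsFiniteMeasure (ν.withDensityᵥ ρ).variation := by rwa [hvar]
  have hint : ∀ F : X → V, Integrable F (ν.withDensityᵥ ρ).variation →
      Integrable F (ν.withDensity fun x => ‖ρ x‖ₑ) := fun F hF => by rwa [← hvar]
  have hnorm : ∀ F : X → ℝ, ∫ x, F x ∂(ν.withDensity fun x => ‖ρ x‖ₑ) =
      ∫ x, F x ∂(ν.withDensityᵥ ρ).variation := fun F => by rw [hvar]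
  rw [← hvar] at hh
  refine Integrable.induction (fun h => (ν.withDensityᵥ ρ).integral h
    (ContinuousLinearMap.lsmul ℝ 𝕜 : 𝕜 →L[ℝ] V →L[ℝ] V).flip = ∫ x, ρ x • h x ∂ν)
    ?_ ?_ ?_ ?_ hh
  · intro c s hs _
    rw [VectorMeasure.integral_indicator_const c hs, withDensityᵥ_apply hρ hs]
    have h1 : (fun x => ρ x • s.indicator (fun _ => c) x) = s.indicator fun x => ρ x • c := by
      ext x
      by_cases hx : x ∈ s <;> simp [hx]
    rw [h1, integral_indicator hs, integral_smul_const]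
    rfl
  · intro f g _ hf hg hPf hPg
    rw [hvar] at hf hg
    have h1 := VectorMeasure.integral_add (B := (ContinuousLinearMap.lsmul ℝ 𝕜 :
      𝕜 →L[ℝ] V →L[ℝ] V).flip) (μ := ν.withDensityᵥ ρ) (f := f) (g := g)
      (by rwa [VectorMeasure.Integrable, hvar]) (by rwa [VectorMeasure.Integrable, hvar])
    have h2 : ∫ x, ρ x • (f + g) x ∂ν = ∫ x, ρ x • f x ∂ν + ∫ x, ρ x • g x ∂ν := by
      rw [← integral_add (hρ.smul_of_withDensity hf) (hρ.smul_of_withDensity hg)]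
      simp
    rw [h2, ← hPf, ← hPg]
    exact h1
  -- Both sides are continuous in `L¹` of the variation `‖ρ‖ ν`, the right one by
  -- `norm_integral_smul_sub_le`.
  · refine isClosed_eq VectorMeasure.continuous_integral ?_
    refine (LipschitzWith.of_dist_le_mul (K := 1) fun f g => ?_).continuous
    have hf := hint _ (L1.integrable_coeFn f)
    have hg := hint _ (L1.integrable_coeFn g)
    rw [dist_eq_norm, dist_eq_norm, L1.norm_eq_integral_norm, NNReal.coe_one, one_mul]
    refine (norm_integral_smul_sub_le hρ hf hg).trans_eq ?_
    rw [hnorm]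
    refine integral_congr_ae ?_
    filter_upwards [Lp.coeFn_sub f g] with x hx
    rw [hx, Pi.sub_apply]
  · intro f g hfg hf hPf
    have hg := hf.congr hfg
    rw [← VectorMeasure.integral_congr_ae hfg, hPf]
    rw [hvar] at hf hg hfg
    have h1 := norm_integral_smul_sub_le hρ hf hg
    have h2 : ∫ x, ‖f x - g x‖ ∂(ν.withDensity fun x => ‖ρ x‖ₑ) = 0 := by
      refine integral_eq_zero_of_ae ?_
      filter_upwards [hfg] with x hx
      simp [hx]
    rw [h2] at h1
    exact sub_eq_zero.1 (norm_le_zero_iff.1 h1)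

end MeasureTheory

/-! ### Integrals over the compact fibres of the core. -/

namespace LocalAnalyticGroupoid

variable {𝕜 : Type} [RCLike 𝕜] {a b : ℕ} {A B : Type*}
  [TopologicalSpace A] [ChartedSpace (Mdl 𝕜 a) A]
  [TopologicalSpace B] [ChartedSpace (Mdl 𝕜 b) B]
  {G : LocalAnalyticGroupoid 𝕜 a b A B} {K : Set A}

lemma continuous_source (G : LocalAnalyticGroupoid 𝕜 a b A B)
    [IsManifold 𝓘(𝕜, Mdl 𝕜 a) ω A] [IsManifold 𝓘(𝕜, Mdl 𝕜 b) ω B] : Continuous G.source :=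
  G.source_submersion.contMDiff.continuous

lemma continuous_target (G : LocalAnalyticGroupoid 𝕜 a b A B)
    [IsManifold 𝓘(𝕜, Mdl 𝕜 a) ω A] [IsManifold 𝓘(𝕜, Mdl 𝕜 b) ω B] : Continuous G.target :=
  G.target_submersion.contMDiff.continuous

lemma IsSProperCore.isCompact_inter_preimage (hK : G.IsSProperCore K) {L : Set B}
    (hL : IsCompact L) : IsCompact {k | k ∈ K ∧ G.source k ∈ L} := by
  have h := (hK.s_proper.isCompact_preimage hL).image continuous_subtype_val
  convert h using 1
  ext k
  simp [and_comm]

lemma IsSProperCore.isCompact_fibre (hK : G.IsSProperCore K) (z : B) :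
    IsCompact (G.fibre K z) :=
  hK.isCompact_inter_preimage isCompact_singleton

lemma continuousOn_mul (G : LocalAnalyticGroupoid 𝕜 a b A B) :
    ContinuousOn (fun x : A × A => G.mul x.1 x.2) G.mulDom :=
  G.mul_analytic.continuousOn

lemma IsSProperCore.continuousOn_mul_right (hK : G.IsSProperCore K) (p : A) :
    ContinuousOn (fun k => G.mul k p) (G.fibre K (G.target p)) :=
  G.continuousOn_mul.comp (f := fun k => (k, p)) (by fun_prop) fun _ hk => hK.no_escape hk

/-- Compactness of the fibre gives the bound. Extension by zero provides a globally bounded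
representative, harmless since `μ z` lives on the fibre. -/
lemma IsSProperCore.exists_norm_indicator_le {V : Type*} [NormedAddCommGroup V]
    (hK : G.IsSProperCore K) (z : B) {f : A → V}
    (hf : ContinuousOn f (G.fibre K z)) : ∃ M, ∀ k, ‖(G.fibre K z).indicator f k‖ ≤ M := by
  obtain ⟨M, hM⟩ := (hK.isCompact_fibre z).exists_bound_of_continuousOn hf
  refine ⟨max M 0, fun k => ?_⟩
  by_cases hk : k ∈ G.fibre K z
  · simpa [hk] using Or.inl (hM k hk)
  · simp [hk]

end LocalAnalyticGroupoid

namespace LocalAnalyticGroupoid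

variable {𝕜 : Type} [RCLike 𝕜] {A : Type*} [MeasurableSpace A]
  {V : Type*} [NormedAddCommGroup V] [NormedSpace 𝕜 V] [NormedSpace ℝ V] [IsScalarTower ℝ 𝕜 V]

lemma norm_integralAgainst_le {ν : VectorMeasure A 𝕜} {T : ℝ≥0} (hν : ν.variation univ ≤ T)
    {f : A → V} {c : ℝ} (hc : 0 ≤ c) (hf : ∀ᵐ k ∂ν.variation, ‖f k‖ ≤ c) :
    ‖integralAgainst ν f‖ ≤ c * T := by
  have : IsFiniteMeasure ν.variation := ⟨hν.trans_lt ENNReal.coe_lt_top⟩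
  refine (VectorMeasure.norm_integral_le_of_norm_le_const hf).trans ?_
  have h1 : ‖(ContinuousLinearMap.lsmul ℝ 𝕜 : 𝕜 →L[ℝ] V →L[ℝ] V).flip‖ ≤ 1 := by
    rw [ContinuousLinearMap.opNorm_flip]
    exact ContinuousLinearMap.opNorm_lsmul_le
  have h2 : ν.variation.real univ ≤ T := ENNReal.toReal_le_of_le_ofReal T.2 (by simpa using hν)
  calc c * ‖(ContinuousLinearMap.lsmul ℝ 𝕜 : 𝕜 →L[ℝ] V →L[ℝ] V).flip‖ * ν.variation.real univ
      ≤ c * 1 * T := by gcongr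
    _ = c * T := by ring

lemma integralAgainst_congr {ν : VectorMeasure A 𝕜} {f g : A → V} (h : f =ᵐ[ν.variation] g) :
    integralAgainst ν f = integralAgainst ν g :=
  VectorMeasure.integral_congr_ae h

lemma integralAgainst_clm [CompleteSpace V] {V' : Type*} [NormedAddCommGroup V'] [NormedSpace 𝕜 V']
    [NormedSpace ℝ V'] [IsScalarTower ℝ 𝕜 V'] [CompleteSpace V'] (ν : VectorMeasure A 𝕜)
    (C : V →L[𝕜] V') {f : A → V} (hf : ν.Integrable f) :
    integralAgainst ν (fun k => C (f k)) = C (integralAgainst ν f) := by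
  have h1 := VectorMeasure.continuousLinearMap_apply_integral
    (B := (ContinuousLinearMap.lsmul ℝ 𝕜 : 𝕜 →L[ℝ] V →L[ℝ] V).flip)
    (C := C.restrictScalars ℝ) hf
  have h2 := VectorMeasure.integral_continuousLinearMap_comp
    (B := (ContinuousLinearMap.lsmul ℝ 𝕜 : 𝕜 →L[ℝ] V' →L[ℝ] V').flip)
    (C := C.restrictScalars ℝ) hf
  have h3 : (ContinuousLinearMap.compL ℝ 𝕜 V V' (C.restrictScalars ℝ)) ∘L
      (ContinuousLinearMap.lsmul ℝ 𝕜 : 𝕜 →L[ℝ] V →L[ℝ] V).flip =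
      (ContinuousLinearMap.lsmul ℝ 𝕜 : 𝕜 →L[ℝ] V' →L[ℝ] V').flip ∘L C.restrictScalars ℝ := by
    ext v r
    simp
  rw [h3] at h1
  exact h2.trans h1.symm

end LocalAnalyticGroupoid

namespace LocalAnalyticGroupoid

lemma IsHaarDensity.integralAgainst_const {𝕜 : Type} [RCLike 𝕜] {a b : ℕ} {A : Type u} {B : Type v}
    [TopologicalSpace A] [ChartedSpace (Mdl 𝕜 a) A] [MeasurableSpace A]
    [TopologicalSpace B] [ChartedSpace (Mdl 𝕜 b) B]
    {G : LocalAnalyticGroupoid 𝕜 a b A B} {K : Set A} {μ : B → VectorMeasure A 𝕜}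
    {V : Type*} [NormedAddCommGroup V] [NormedSpace 𝕜 V] [NormedSpace ℝ V] [IsScalarTower ℝ 𝕜 V]
    [CompleteSpace V] (hμ : G.IsHaarDensity K μ) (z : B)
    [IsFiniteMeasure (μ z).variation] (v : V) : integralAgainst (μ z) (fun _ => v) = v := by
  rw [integralAgainst, VectorMeasure.integral_const, hμ.normalised]
  simp

end LocalAnalyticGroupoid

namespace LocalAnalyticGroupoid

variable {𝕜 : Type} [RCLike 𝕜] {a b : ℕ} {A : Type u} {B : Type v}
  [TopologicalSpace A] [T2Space A] [ChartedSpace (Mdl 𝕜 a) A] [MeasurableSpace A] [BorelSpace A]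
  [TopologicalSpace B] [ChartedSpace (Mdl 𝕜 b) B]
  {G : LocalAnalyticGroupoid 𝕜 a b A B} {K : Set A} {μ : B → VectorMeasure A 𝕜}
  {V : Type*} [NormedAddCommGroup V]

lemma IsSProperCore.measurableSet_fibre (hK : G.IsSProperCore K) (z : B) :
    MeasurableSet (G.fibre K z) :=
  (hK.isCompact_fibre z).isClosed.measurableSet

lemma IsHaarDensity.ae_mem_fibre (hμ : G.IsHaarDensity K μ) (hK : G.IsSProperCore K) (z : B) :
    ∀ᵐ k ∂(μ z).variation, k ∈ G.fibre K z := by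
  refine (VectorMeasure.variation_apply_eq_zero (hK.measurableSet_fibre z).compl).2 ?_
  exact fun t ht hm => hμ.supported z t hm (disjoint_left.2 fun x hx hx' => ht hx hx')

lemma IsSProperCore.aestronglyMeasurable_indicator (hK : G.IsSProperCore K) (z : B) {f : A → V}
    (hf : ContinuousOn f (G.fibre K z)) (m : Measure A) :
    AEStronglyMeasurable ((G.fibre K z).indicator f) m :=
  (aestronglyMeasurable_indicator_iff (hK.measurableSet_fibre z)).2
    (hf.aestronglyMeasurable_of_isCompact (hK.isCompact_fibre z) (hK.measurableSet_fibre z))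

lemma IsHaarDensity.indicator_ae_eq (hμ : G.IsHaarDensity K μ) (hK : G.IsSProperCore K) (z : B)
    (f : A → V) : (G.fibre K z).indicator f =ᵐ[(μ z).variation] f := by
  filter_upwards [hμ.ae_mem_fibre hK z] with k hk
  simp [hk]

lemma IsHaarDensity.integrable (hμ : G.IsHaarDensity K μ) (hK : G.IsSProperCore K) (z : B)
    [IsFiniteMeasure (μ z).variation] {f : A → V} (hf : ContinuousOn f (G.fibre K z)) :
    (μ z).Integrable f := by
  obtain ⟨M, hM⟩ := hK.exists_norm_indicator_le z hf
  exact (Integrable.of_bound (hK.aestronglyMeasurable_indicator z hf _) M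
    (ae_of_all _ hM)).congr (hμ.indicator_ae_eq hK z f)

variable [NormedSpace 𝕜 V] [NormedSpace ℝ V] [IsScalarTower ℝ 𝕜 V]

/-- Right invariance of the integral. -/
lemma IsHaarDensity.integralAgainst_mul_right (hμ : G.IsHaarDensity K μ) (hK : G.IsSProperCore K)
    {k : A} (hk : k ∈ K) [IsFiniteMeasure (μ (G.target k)).variation] {f : A → V}
    (hf : ContinuousOn f (G.fibre K (G.source k))) :
    integralAgainst (μ (G.target k)) (fun l => f (G.mul l k)) =
      integralAgainst (μ (G.source k)) f := by
  classical
  -- Right multiplication, extended by a constant off the fibre to be measurable on all of `A`; the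
  -- junk value lies on a null set.
  set r : A → A := (G.fibre K (G.target k)).piecewise (fun l => G.mul l k) fun _ => k with hr
  have hrm : Measurable r := ContinuousOn.measurable_piecewise (hK.continuousOn_mul_right k)
    continuousOn_const (hK.measurableSet_fibre _)
  have hrf : ∀ l ∈ G.fibre K (G.target k), r l = G.mul l k := fun l hl => by simp [hr, hl]
  have hmap : (μ (G.target k)).map r = μ (G.source k) := by
    ext S hS
    rw [VectorMeasure.map_apply _ hrm hS, ← hμ.right_invariant k hk S hS]
    have hF := hK.measurableSet_fibre (G.target k)
    have hset : {l | l ∈ G.fibre K (G.target k) ∧ G.mul l k ∈ S} =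
        r ⁻¹' S ∩ G.fibre K (G.target k) := by
      ext l
      constructor
      · rintro ⟨h1, h2⟩
        exact ⟨by simpa [hrf l h1] using h2, h1⟩
      · rintro ⟨h1, h2⟩
        exact ⟨h2, by simpa [hrf l h2] using h1⟩
    rw [hset, ← VectorMeasure.of_add_of_sdiff ((hrm hS).inter hF) (hrm hS) inter_subset_left,
      hμ.supported (G.target k) _ ((hrm hS).diff ((hrm hS).inter hF))
        (disjoint_left.2 fun x hx hx' => hx.2 ⟨hx.1, hx'⟩), add_zero]
  obtain ⟨M, hM⟩ := hK.exists_norm_indicator_le _ hf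
  have hmeas := hK.aestronglyMeasurable_indicator _ hf ((μ (G.target k)).variation.map r)
  rw [← integralAgainst_congr (hμ.indicator_ae_eq hK _ f), ← hmap, integralAgainst,
    integralAgainst, VectorMeasure.integral_map hrm hmeas (Integrable.of_bound
      (hmeas.comp_measurable hrm) M (ae_of_all _ fun l => hM _))]
  refine VectorMeasure.integral_congr_ae ?_
  filter_upwards [hμ.ae_mem_fibre hK (G.target k)] with l hl
  rw [hrf l hl, indicator_of_mem ((hK.right_mul k hk).1 hl)]

/-- Integration in a fibred chart. -/
lemma FibredChart.integralAgainst_eq [CompleteSpace V] (hμ : G.IsHaarDensity K μ)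
    (hK : G.IsSProperCore K) (c : G.FibredChart K) (k₀ : A) {z : B} {ρ : EuclideanSpace ℝ (Fin c.d) → 𝕜}
    (hdom : MeasurableSet {y | (z, y) ∈ c.dom})
    (hparam : ContinuousOn (fun y => c.param (z, y)) {y | (z, y) ∈ c.dom})
    (hρ : IntegrableOn ρ {y | (z, y) ∈ c.dom})
    (hμρ : ∀ S, MeasurableSet S → S ⊆ c.amb →
      μ z S = ∫ y in {y | (z, y) ∈ c.dom ∧ c.param (z, y) ∈ S}, ρ y)
    {f : A → V} (hf : ContinuousOn f (G.fibre K z)) (hf0 : ∀ k ∉ c.amb, f k = 0) :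
    integralAgainst (μ z) f = ∫ y in {y | (z, y) ∈ c.dom}, ρ y • f (c.param (z, y)) := by
  classical
  set D := {y | (z, y) ∈ c.dom} with hD
  set r : EuclideanSpace ℝ (Fin c.d) → A := D.piecewise (fun y => c.param (z, y)) fun _ => k₀ with hr
  have hrm : Measurable r := ContinuousOn.measurable_piecewise hparam continuousOn_const hdom
  have hrf : ∀ y ∈ D, r y = c.param (z, y) := fun y hy => by simp [hr, hy]
  have hamb := c.amb_open.measurableSet
  -- On the chart, `μ z` is the push-forward of `ρ` times Lebesgue measure; `r` is the
  -- parametrisation with a junk value off `D`.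
  have hmap : (μ z).restrict c.amb = ((volume.restrict D).withDensityᵥ ρ).map r := by
    ext S hS
    rw [VectorMeasure.map_apply _ hrm hS, VectorMeasure.restrict_apply _ hamb hS,
      withDensityᵥ_apply hρ (hrm hS), hμρ _ (hS.inter hamb) inter_subset_right,
      Measure.restrict_restrict (hrm hS)]
    congr 2
    ext y
    constructor
    · rintro ⟨h1, h2⟩
      exact ⟨by simpa [hrf y h1] using h2.1, h1⟩
    · rintro ⟨h1, h2⟩
      exact ⟨h2, by simpa [hrf y h2] using h1, (c.param_mem _ h2).2⟩
  set f' := (G.fibre K z).indicator f with hf'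
  obtain ⟨M, hM⟩ := hK.exists_norm_indicator_le _ hf
  have hvar := Measure.variation_withDensityᵥ hρ
  have : IsFiniteMeasure ((volume.restrict D).withDensity fun y => ‖ρ y‖ₑ) :=
    isFiniteMeasure_withDensity hρ.2.ne
  have hfin : IsFiniteMeasure ((volume.restrict D).withDensityᵥ ρ).variation := by rwa [hvar]
  have hmeas := hK.aestronglyMeasurable_indicator _ hf
    (((volume.restrict D).withDensityᵥ ρ).variation.map r)
  have hint : Integrable (f' ∘ r) ((volume.restrict D).withDensityᵥ ρ).variation :=
    Integrable.of_bound (hmeas.comp_measurable hrm) M (ae_of_all _ fun l => hM _)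
  have h1 : c.amb.indicator f' = f' := by
    refine indicator_eq_self.2 fun k hk => ?_
    by_contra h
    exact hk (by simp [hf', indicator_apply, hf0 k h])
  rw [← integralAgainst_congr (hμ.indicator_ae_eq hK _ f), ← hf', ← h1, integralAgainst,
    VectorMeasure.integral_indicator hamb, hmap, VectorMeasure.integral_map hrm hmeas hint,
    integral_withDensityᵥ hρ (h := fun y => f' (r y)) (by rw [← hvar]; exact hint)]
  refine setIntegral_congr_fun hdom fun y hy => ?_
  have h2 : c.param (z, y) ∈ G.fibre K z := ⟨(c.param_mem _ hy).1, c.source_param _ hy⟩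
  simp only [hrf y hy, hf', indicator_of_mem h2]

end LocalAnalyticGroupoid

namespace LocalAnalyticGroupoid

lemma continuousOn_fibre_of_uncurry {𝕜 : Type} [RCLike 𝕜] {a b : ℕ} {A B X V : Type*}
    [TopologicalSpace A] [ChartedSpace (Mdl 𝕜 a) A] [TopologicalSpace B] [ChartedSpace (Mdl 𝕜 b) B]
    [TopologicalSpace X] [TopologicalSpace V]
    {G : LocalAnalyticGroupoid 𝕜 a b A B} {K : Set A} {τ : X → B} {F : X → A → V}
    (hF : ContinuousOn (fun q : X × A => F q.1 q.2) {q | q.2 ∈ K ∧ G.source q.2 = τ q.1}) (x : X) :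
    ContinuousOn (F x) (G.fibre K (τ x)) :=
  hF.comp (f := fun k => (x, k)) (by fun_prop) fun _ hk => hk

end LocalAnalyticGroupoid

/-! ### Continuous dependence of fibre integrals on parameters. -/

namespace LocalAnalyticGroupoid

variable {𝕜 : Type} [RCLike 𝕜] {a b : ℕ} {A : Type u} {B : Type v}
  [TopologicalSpace A] [T2Space A] [ChartedSpace (Mdl 𝕜 a) A] [MeasurableSpace A] [BorelSpace A]
  [TopologicalSpace B] [T2Space B] [ChartedSpace (Mdl 𝕜 b) B]
  {G : LocalAnalyticGroupoid 𝕜 a b A B} {K : Set A} {μ : B → VectorMeasure A 𝕜}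
  {V : Type*} [NormedAddCommGroup V] [NormedSpace 𝕜 V] [NormedSpace ℝ V] [IsScalarTower ℝ 𝕜 V]
  [CompleteSpace V] {X : Type*} [TopologicalSpace X]

/-- In fibred coordinates this is a Lebesgue integral over a fixed `ℝᵈ` of an integrand extended by
zero. Over compact `L` that extension is jointly continuous with support in one compact set. -/
lemma IsSProperCore.continuousOn_integralAgainst_of_chart (hμ : G.IsHaarDensity K μ)
    (hK : G.IsSProperCore K) (hs : Continuous G.source) (c : G.FibredChart K) (k₀ : A)
    {ρ : B × EuclideanSpace ℝ (Fin c.d) → 𝕜}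
    (hρ : ContinuousOn ρ c.dom)
    (hμρ : ∀ z, IntegrableOn (fun y => ρ (z, y)) {y | (z, y) ∈ c.dom} ∧
        ∀ S, MeasurableSet S → S ⊆ c.amb →
          μ z S = ∫ y in {y | (z, y) ∈ c.dom ∧ c.param (z, y) ∈ S}, ρ (z, y))
    {χ : A → ℝ} (hχ : Continuous χ) (hχc : tsupport χ ⊆ c.amb) {L : Set B} (hL : IsCompact L)
    {τ : X → B} (hτ : Continuous τ) {F : X → A → V}
    (hF : ContinuousOn (fun q : X × A => F q.1 q.2) {q | q.2 ∈ K ∧ G.source q.2 = τ q.1}) :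
    ContinuousOn (fun x => integralAgainst (μ (τ x)) fun k => χ k • F x k) (τ ⁻¹' L) := by
  classical
  have hdomo : ∀ z, IsOpen {y | (z, y) ∈ c.dom} := fun z => c.dom_open.preimage (by fun_prop)
  have hpc : ContinuousOn c.param c.dom := c.param_analytic.continuousOn
  have heq : ∀ x, integralAgainst (μ (τ x)) (fun k => χ k • F x k) =
      ∫ y, if (τ x, y) ∈ c.dom then
        ρ (τ x, y) • χ (c.param (τ x, y)) • F x (c.param (τ x, y)) else 0 := by
    intro x
    have hχF : ContinuousOn (fun k => χ k • F x k) (G.fibre K (τ x)) :=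
      hχ.continuousOn.smul (continuousOn_fibre_of_uncurry hF x)
    rw [c.integralAgainst_eq hμ hK k₀ (hdomo (τ x)).measurableSet
      (hpc.comp (by fun_prop) fun y hy => hy) (hμρ (τ x)).1 (hμρ (τ x)).2
      hχF
      (fun k hk => by rw [image_eq_zero_of_notMem_tsupport fun h => hk (hχc h), zero_smul]),
      ← integral_indicator (hdomo (τ x)).measurableSet]
    rfl
  simp_rw [heq]
  -- The coordinates of the part of `K` over `L` inside the support of `χ`, compact because the
  -- source is proper on `K`.
  set Q : Set (B × EuclideanSpace ℝ (Fin c.d)) :=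
    (fun k => (G.source k, c.coord k)) '' ({k | k ∈ K ∧ G.source k ∈ L} ∩ tsupport χ) with hQ
  have hQc : IsCompact Q := by
    refine ((hK.isCompact_inter_preimage hL).inter_right (isClosed_tsupport χ)).image_of_continuousOn
      (hs.continuousOn.prodMk (c.coord_analytic.continuousOn.mono ?_))
    exact fun k hk => ⟨hk.1.1, hχc hk.2⟩
  have hzero : ∀ x y, τ x ∈ L → (τ x, y) ∉ Q → (if (τ x, y) ∈ c.dom then
        ρ (τ x, y) • χ (c.param (τ x, y)) • F x (c.param (τ x, y)) else 0) = 0 := by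
    intro x y hx hy
    split_ifs with hd
    · by_cases h : c.param (τ x, y) ∈ tsupport χ
      · refine absurd ⟨c.param (τ x, y), ⟨⟨(c.param_mem _ hd).1, ?_⟩, h⟩, ?_⟩ hy
        · rwa [c.source_param _ hd]
        · simp [c.source_param _ hd, c.coord_param _ hd]
      · rw [image_eq_zero_of_notMem_tsupport h, zero_smul, smul_zero]
    · rfl
  refine continuousOn_integral_of_compact_support (hQc.image continuous_snd) ?_ ?_
  swap
  · exact fun x y hx hy => hzero x y hx fun h => hy ⟨_, h, rfl⟩
  rintro ⟨x, y⟩ ⟨hx, -⟩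
  by_cases hd : (τ x, y) ∈ c.dom
  · have hτ' : Continuous fun q : X × EuclideanSpace ℝ (Fin c.d) => (τ q.1, q.2) := by fun_prop
    have hU : IsOpen {q : X × EuclideanSpace ℝ (Fin c.d) | (τ q.1, q.2) ∈ c.dom} :=
      c.dom_open.preimage hτ'
    have h1 : ContinuousOn (fun q : X × EuclideanSpace ℝ (Fin c.d) => c.param (τ q.1, q.2))
        {q | (τ q.1, q.2) ∈ c.dom} := hpc.comp hτ'.continuousOn fun q hq => hq
    have h2 : ContinuousOn (fun q : X × EuclideanSpace ℝ (Fin c.d) => ρ (τ q.1, q.2) •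
        χ (c.param (τ q.1, q.2)) • F q.1 (c.param (τ q.1, q.2))) {q | (τ q.1, q.2) ∈ c.dom} := by
      refine (hρ.comp hτ'.continuousOn fun q hq => hq).smul
        ((hχ.comp_continuousOn h1).smul ?_)
      exact hF.comp (f := fun q : X × EuclideanSpace ℝ (Fin c.d) => (q.1, c.param (τ q.1, q.2)))
        (continuousOn_fst.prodMk h1) fun q hq => ⟨(c.param_mem _ hq).1, c.source_param _ hq⟩
    refine ContinuousAt.continuousWithinAt ?_
    refine (h2.continuousAt (hU.mem_nhds hd)).congr ?_
    filter_upwards [hU.mem_nhds hd] with q hq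
    have hq' : (τ q.1, q.2) ∈ c.dom := hq
    simp [Function.uncurry, hq']
  -- A point outside the chart domain is off the closed set `Q`, so the extended integrand vanishes
  -- near it over `L`.
  · have hnQ : (τ x, y) ∉ Q := by
      rintro ⟨k, hk, hke⟩
      exact hd (hke ▸ c.mem_dom k ⟨hk.1.1, hχc hk.2⟩)
    have hU : IsOpen {q : X × EuclideanSpace ℝ (Fin c.d) | (τ q.1, q.2) ∉ Q} :=
      hQc.isClosed.isOpen_compl.preimage (by fun_prop)
    refine (continuousWithinAt_const (b := (0 : V))).congr_of_eventuallyEq ?_ ?_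
    · filter_upwards [self_mem_nhdsWithin, mem_nhdsWithin_of_mem_nhds (hU.mem_nhds hnQ)] with q hq hq'
      exact hzero q.1 q.2 hq.1 hq'
    · exact hzero x y hx hnQ

/-- The integral along the fibres of the core depends continuously on parameters. -/
lemma IsSProperCore.continuous_integralAgainst (hK : G.IsSProperCore K)
    (hμ : G.IsHaarDensity K μ) (hfin : ∀ z, IsFiniteMeasure (μ z).variation)
    (hs : Continuous G.source)
    {τ : X → B} (hτ : Continuous τ) {F : X → A → V}
    (hF : ContinuousOn (fun q : X × A => F q.1 q.2) {q | q.2 ∈ K ∧ G.source q.2 = τ q.1}) :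
    Continuous fun x => integralAgainst (μ (τ x)) (F x) := by
  have : LocallyCompactSpace A := Manifold.locallyCompact_of_finiteDimensional 𝓘(𝕜, Mdl 𝕜 a)
  have : LocallyCompactSpace B := Manifold.locallyCompact_of_finiteDimensional 𝓘(𝕜, Mdl 𝕜 b)
  rw [continuous_iff_continuousAt]
  intro x₀
  obtain ⟨L, hL, hLn⟩ := exists_compact_mem_nhds (τ x₀)
  have hKL := hK.isCompact_inter_preimage hL
  choose c hcm ρ hρ hμρ using hμ.analytic_density
  obtain ⟨t, ht⟩ := hKL.elim_nhds_subcover' (fun k hk => (c k hk.1).amb)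
    fun k hk => (c k hk.1).amb_open.mem_nhds (hcm k hk.1)
  let e := t.equivFin
  -- A partition of unity over finitely many charts covering the part of `K` above `L` reduces to a
  -- single chart.
  obtain ⟨χ, hχc, hχs, -, -⟩ := exists_continuous_sum_one_of_isOpen_isCompact
    (s := fun i => (c (e.symm i).1.1 (e.symm i).1.2.1).amb)
    (fun i => (c (e.symm i).1.1 (e.symm i).1.2.1).amb_open) hKL (by
      intro k hk
      obtain ⟨l, hl, hkl⟩ := mem_iUnion₂.1 (ht hk)
      exact mem_iUnion.2 ⟨e ⟨l, hl⟩, by simpa using hkl⟩)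
  have hpiece : ∀ i, ContinuousAt
      (fun x => integralAgainst (μ (τ x)) fun k => χ i k • F x k) x₀ := fun i =>
    (hK.continuousOn_integralAgainst_of_chart hμ hs (c _ (e.symm i).1.2.1) (e.symm i).1.1
      (hρ _ (e.symm i).1.2.1).continuousOn (hμρ _ (e.symm i).1.2.1) (χ i).continuous (hχc i)
      hL hτ hF).continuousAt (hτ.continuousAt hLn)
  have hsum : ContinuousAt
      (fun x => ∑ i, integralAgainst (μ (τ x)) fun k => χ i k • F x k) x₀ :=
    tendsto_finsetSum _ fun i _ => hpiece i
  refine hsum.congr ?_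
  filter_upwards [hτ.continuousAt hLn] with x hx
  have hint : ∀ i ∈ Finset.univ, (μ (τ x)).Integrable (fun k => χ i k • F x k) := fun i _ =>
    hμ.integrable hK _ ((χ i).continuous.continuousOn.smul (continuousOn_fibre_of_uncurry hF x))
  have h1 : integralAgainst (μ (τ x)) (fun k => ∑ i, χ i k • F x k) =
      ∑ i, integralAgainst (μ (τ x)) fun k => χ i k • F x k :=
    VectorMeasure.integral_finsetSum _ hint
  rw [← h1]
  refine integralAgainst_congr ?_
  filter_upwards [hμ.ae_mem_fibre hK (τ x)] with k hk
  have h2 : (∑ i, ⇑(χ i)) k = 1 := hχs ⟨hk.1, by rw [hk.2]; exact hx⟩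
  rw [← Finset.sum_smul, ← Finset.sum_apply, h2, one_smul]

end LocalAnalyticGroupoid

lemma NormedLie.IsLieNorm.eq_of_mdlExp_eq {𝕜 : Type} [RCLike 𝕜] {n : ℕ} {H : Type*}
    [TopologicalSpace H] [ChartedSpace (Mdl 𝕜 n) H] [Group H] {N : Alg 𝕜 n H → ℝ}
    (hN : IsLieNorm N) {u v : Mdl 𝕜 n} (hu : mdlNorm N u ≤ 1)
    (hv : mdlNorm N v ≤ 1) (h : mdlExp 𝕜 n H u = mdlExp 𝕜 n H v) : u = v := by
  rw [← hN.mdlLog_mdlExp hu, h, hN.mdlLog_mdlExp hv]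

/-! ### Linearisation of the cocycle identity. -/

namespace NormedLie.IsLieNorm

variable {𝕜 : Type} [RCLike 𝕜] {n : ℕ} {H : Type*} [TopologicalSpace H] [T2Space H]
  [ChartedSpace (Mdl 𝕜 n) H] [Group H] [LieGroup 𝓘(𝕜, Mdl 𝕜 n) ω H] {N : Alg 𝕜 n H → ℝ}

/-- Linearisation of the equation `exp x exp y = g⁻¹ exp w g exp z`, uniformly for `g` in a
compact set. -/
lemma exists_linearisation (hN : IsLieNorm N) {K : Set H} (hK : IsCompact K) :
    ∃ r > 0, ∃ C : ℝ, 0 < C ∧ ∀ g ∈ K, ∃ Λ₁ Λ : Mdl 𝕜 n × Mdl 𝕜 n →L[𝕜] Mdl 𝕜 n,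
      ∀ s ≤ r, ∀ x y w z : Mdl 𝕜 n, ‖x‖ ≤ s → ‖y‖ ≤ s → ‖w‖ ≤ s → ‖z‖ ≤ s →
        (mdlExp 𝕜 n H x * mdlExp 𝕜 n H y = g⁻¹ * mdlExp 𝕜 n H w * g * mdlExp 𝕜 n H z →
          ‖Λ₁ (x, y) - Λ (w, z)‖ ≤ C * s ^ 2) ∧
        ∃ m, mdlExp 𝕜 n H m = (g⁻¹ * mdlExp 𝕜 n H w * g * mdlExp 𝕜 n H z)⁻¹ *
            (mdlExp 𝕜 n H x * mdlExp 𝕜 n H y) ∧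
          ‖m‖ ≤ C * (s ^ 2 + ‖Λ₁ (x, y) - Λ (w, z)‖) := by
  -- Adding `1` to `K` treats the untwisted product `exp x exp y` as the case `g = 1`. The linear
  -- maps need not be computed.
  obtain ⟨r₁, hr₁, C, hC, h₁⟩ := hN.exists_conj_mul_approx (hK.insert 1)
  obtain ⟨r₂, hr₂, L, hL, h₂⟩ := hN.exists_inv_mul_le
  obtain ⟨r₃, hr₃, h₃⟩ := hN.exists_ball
  -- For `s ≤ 1` both logarithms are at most `C s² + C s ≤ 2 C s`; the last bound puts them where
  -- `exp` is injective and `exists_inv_mul_le` applies.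
  refine ⟨min (min r₁ 1) (min r₂ r₃ / (2 * C)), by positivity, max (2 * C) (L * (2 * C + 1)),
    by positivity, fun g hg => ?_⟩
  obtain ⟨Λ₁, hΛ₁, h1⟩ := h₁ 1 (mem_insert _ _)
  obtain ⟨Λ, hΛ, hg⟩ := h₁ g (mem_insert_of_mem _ hg)
  refine ⟨Λ₁, Λ, fun s hs x y w z hx hy hw hz => ?_⟩
  have hs0 : 0 ≤ s := (norm_nonneg x).trans hx
  have hxy : ‖(x, y)‖ ≤ s := by simp [Prod.norm_def, hx, hy]
  have hwz : ‖(w, z)‖ ≤ s := by simp [Prod.norm_def, hw, hz]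
  have hsr₁ : s ≤ r₁ := hs.trans ((min_le_left _ _).trans (min_le_left _ _))
  have hs1 : s ≤ 1 := hs.trans ((min_le_left _ _).trans (min_le_right _ _))
  have hsC : 2 * C * s ≤ min r₂ r₃ := by
    have := hs.trans (min_le_right _ _)
    rw [le_div_iff₀ (by positivity)] at this
    linarith
  have hsmall : ∀ (u : Mdl 𝕜 n × Mdl 𝕜 n) (M : Mdl 𝕜 n × Mdl 𝕜 n →L[𝕜] Mdl 𝕜 n) (m : Mdl 𝕜 n),
      ‖u‖ ≤ s → ‖M‖ ≤ C → ‖m - M u‖ ≤ C * ‖u‖ ^ 2 →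
      ‖m‖ ≤ min r₂ r₃ ∧ ‖m - M u‖ ≤ C * s ^ 2 := by
    intro u M m hu hM hm
    have e1 : ‖m - M u‖ ≤ C * s ^ 2 := hm.trans (by gcongr)
    refine ⟨?_, e1⟩
    have e2 : ‖M u‖ ≤ C * s := (M.le_opNorm u).trans (by gcongr)
    have e3 : ‖m‖ ≤ ‖m - M u‖ + ‖M u‖ := by simpa using norm_add_le (m - M u) (M u)
    have e4 : s ^ 2 ≤ s := by nlinarith
    nlinarith
  obtain ⟨m₁, he₁, hm₁⟩ := h1 (x, y) (hxy.trans hsr₁)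
  obtain ⟨m, he, hm⟩ := hg (w, z) (hwz.trans hsr₁)
  obtain ⟨hm₁r, hm₁⟩ := hsmall _ _ _ hxy hΛ₁ hm₁
  obtain ⟨hmr, hm⟩ := hsmall _ _ _ hwz hΛ hm
  have he₁ : mdlExp 𝕜 n H m₁ = mdlExp 𝕜 n H x * mdlExp 𝕜 n H y := by simpa using he₁
  constructor
  · intro heq
    have hmm : m₁ = m := hN.eq_of_mdlExp_eq (h₃ _ (hm₁r.trans (min_le_right _ _))).le
      (h₃ _ (hmr.trans (min_le_right _ _))).le (by rw [he₁, he, heq])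
    calc ‖Λ₁ (x, y) - Λ (w, z)‖ = ‖(m - Λ (w, z)) - (m₁ - Λ₁ (x, y))‖ := by rw [hmm]; congr 1; abel
      _ ≤ ‖m - Λ (w, z)‖ + ‖m₁ - Λ₁ (x, y)‖ := norm_sub_le _ _
      _ ≤ 2 * C * s ^ 2 := by linarith
      _ ≤ _ := by gcongr; exact le_max_left _ _
  · obtain ⟨m', he', hm'⟩ := h₂ m m₁ (hmr.trans (min_le_left _ _)) (hm₁r.trans (min_le_left _ _))
    refine ⟨m', by rw [he', he, he₁], hm'.trans ?_⟩
    have e1 : ‖m - m₁‖ ≤ 2 * C * s ^ 2 + ‖Λ₁ (x, y) - Λ (w, z)‖ := by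
      calc ‖m - m₁‖ = ‖((m - Λ (w, z)) - (m₁ - Λ₁ (x, y))) - (Λ₁ (x, y) - Λ (w, z))‖ := by
            congr 1; abel
        _ ≤ ‖(m - Λ (w, z)) - (m₁ - Λ₁ (x, y))‖ + ‖Λ₁ (x, y) - Λ (w, z)‖ := norm_sub_le _ _
        _ ≤ ‖m - Λ (w, z)‖ + ‖m₁ - Λ₁ (x, y)‖ + ‖Λ₁ (x, y) - Λ (w, z)‖ := by
            gcongr; exact norm_sub_le _ _
        _ ≤ _ := by linarith
    calc L * ‖m - m₁‖ ≤ L * (2 * C * s ^ 2 + ‖Λ₁ (x, y) - Λ (w, z)‖) := by gcongr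
      _ ≤ L * (2 * C + 1) * (s ^ 2 + ‖Λ₁ (x, y) - Λ (w, z)‖) := by
          have := norm_nonneg (Λ₁ (x, y) - Λ (w, z))
          have : 0 ≤ L * (s ^ 2 + 2 * C * ‖Λ₁ (x, y) - Λ (w, z)‖) := by positivity
          nlinarith
      _ ≤ _ := by gcongr; exact le_max_right _ _

end NormedLie.IsLieNorm

/-- The cocycle identity for `ψ`. -/
lemma LocalAnalyticGroupoid.IsSProperCore.psi_mul_psi {𝕜 : Type} [RCLike 𝕜] {a b : ℕ}
    {A B H : Type*} [TopologicalSpace A] [ChartedSpace (Mdl 𝕜 a) A]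
    [TopologicalSpace B] [ChartedSpace (Mdl 𝕜 b) B] [Group H]
    {G : LocalAnalyticGroupoid 𝕜 a b A B} {K : Set A} (hK : G.IsSProperCore K) (φ : A → H) {k p l : A}
    (hkp : (k, p) ∈ G.corePairs K) (hl : l ∈ G.fibre K (G.target k)) :
    G.psi φ k p * G.psi φ l (G.mul k p) =
      (φ p)⁻¹ * G.psi φ l k * φ p * G.psi φ (G.mul l k) p := by
  have hlk : (l, k) ∈ G.mulDom := hK.no_escape hl
  -- `lk` is again in the core, so `(lk, p)` can be multiplied. With `(lk)p = l(kp)`, both sides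
  -- reduce to `φ(p)⁻¹ φ(k)⁻¹ φ(l)⁻¹ φ(lkp)`.
  have h := (G.mul_assoc l k p hlk (hK.no_escape hkp)
    (hK.no_escape ⟨((hK.right_mul k hkp.1).1 hl).1, by rw [G.source_mul _ _ hlk]; exact hkp.2⟩)).2
  simp only [psi, h]
  group

/-! ### One averaging step. -/

namespace LocalAnalyticGroupoid

open NormedLie

variable {𝕜 : Type} [RCLike 𝕜] {a b n : ℕ} {A B H : Type*}
  [TopologicalSpace A] [ChartedSpace (Mdl 𝕜 a) A]
  [TopologicalSpace B] [ChartedSpace (Mdl 𝕜 b) B]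
  [TopologicalSpace H] [ChartedSpace (Mdl 𝕜 n) H] [Group H]
  {G : LocalAnalyticGroupoid 𝕜 a b A B} {K : Set A} {N : Alg 𝕜 n H → ℝ} {φ : A → H} {δ : ℝ}

/-- The values of `ψ` on the core pairs are exponentials of vectors of norm at most `δ`. -/
def HasSmallDefect (n : ℕ) [ChartedSpace (Mdl 𝕜 n) H] (G : LocalAnalyticGroupoid 𝕜 a b A B)
    (K : Set A) (φ : A → H) (δ : ℝ) : Prop :=
  ∀ x ∈ G.corePairs K, ∃ v : Mdl 𝕜 n, ‖v‖ ≤ δ ∧ mdlExp 𝕜 n H v = G.psi φ x.1 x.2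

lemma HasSmallDefect.logPsi (h : G.HasSmallDefect n K φ δ) (hN : IsLieNorm N)
    (hδ : ∀ v : Mdl 𝕜 n, ‖v‖ ≤ δ → mdlNorm N v ≤ 1) {k p : A} (hkp : (k, p) ∈ G.corePairs K) :
    G.psi φ k p ∈ expBall N ∧ ‖G.logPsi N φ p k‖ ≤ δ ∧
      mdlExp 𝕜 n H (G.logPsi N φ p k) = G.psi φ k p := by
  obtain ⟨v, hv, hve⟩ := h _ hkp
  have h1 : G.logPsi N φ p k = v := by
    have := hN.mdlLog_mdlExp (hδ v hv)
    rw [hve] at this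
    exact this
  refine ⟨?_, by rwa [h1], by rwa [h1]⟩
  rw [← hve]
  exact IsLieNorm.mdlExp_mem_expBall (hδ v hv)

variable [LieGroup 𝓘(𝕜, Mdl 𝕜 n) ω H]

lemma HasSmallDefect.continuousOn_logPsi (h : G.HasSmallDefect n K φ δ) (hK : G.IsSProperCore K)
    (hN : IsLieNorm N) (hδ : ∀ v : Mdl 𝕜 n, ‖v‖ ≤ δ → mdlNorm N v ≤ 1) (hφ : Continuous φ) :
    ContinuousOn (fun q : A × A => G.logPsi N φ q.1 q.2)
      {q | q.2 ∈ K ∧ G.source q.2 = G.target q.1} := by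
  have : IsTopologicalGroup H := topologicalGroup_of_lieGroup 𝓘(𝕜, Mdl 𝕜 n) ω
  have h1 : ContinuousOn (fun q : A × A => G.psi φ q.2 q.1)
      {q | q.2 ∈ K ∧ G.source q.2 = G.target q.1} := by
    have h2 : ContinuousOn (fun q : A × A => G.mul q.2 q.1)
        {q | q.2 ∈ K ∧ G.source q.2 = G.target q.1} :=
      G.continuousOn_mul.comp (f := Prod.swap) (by fun_prop) fun q hq => hK.no_escape hq
    exact (by fun_prop : Continuous fun q : A × A => (φ q.1)⁻¹ * (φ q.2)⁻¹).continuousOn.mul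
      (hφ.comp_continuousOn h2)
  exact hN.continuousOn_mdlLog.comp h1 fun q hq => (h.logPsi hN hδ (k := q.2) (p := q.1) hq).1

end LocalAnalyticGroupoid

namespace LocalAnalyticGroupoid

open NormedLie

/-- The exponent of the average. -/
def logAverage {𝕜 : Type} [RCLike 𝕜] {a b n : ℕ} {A B H : Type*}
    [TopologicalSpace A] [ChartedSpace (Mdl 𝕜 a) A] [MeasurableSpace A]
    [TopologicalSpace B] [ChartedSpace (Mdl 𝕜 b) B]
    [TopologicalSpace H] [ChartedSpace (Mdl 𝕜 n) H] [Group H]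
    (G : LocalAnalyticGroupoid 𝕜 a b A B) (μ : B → VectorMeasure A 𝕜)
    (N : Alg 𝕜 n H → ℝ) (φ : A → H) (p : A) : Mdl 𝕜 n :=
  integralAgainst (μ (G.target p)) (G.logPsi N φ p)

variable {𝕜 : Type} [RCLike 𝕜] {n : ℕ} {H : Type*} [TopologicalSpace H]
  [ChartedSpace (Mdl 𝕜 n) H] [Group H] {N : Alg 𝕜 n H → ℝ}
  {a b : ℕ} {A : Type u} {B : Type v} [TopologicalSpace A] [ChartedSpace (Mdl 𝕜 a) A]
  [TopologicalSpace B] [ChartedSpace (Mdl 𝕜 b) B]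
  {G : LocalAnalyticGroupoid 𝕜 a b A B} {core : Set A} {φ : A → H} {δ : ℝ}

lemma HasSmallDefect.continuousOn_fibre_logPsi [LieGroup 𝓘(𝕜, Mdl 𝕜 n) ω H]
    (h : G.HasSmallDefect n core φ δ) (hN : IsLieNorm N)
    (hcore : G.IsSProperCore core) (hδ : ∀ v : Mdl 𝕜 n, ‖v‖ ≤ δ → mdlNorm N v ≤ 1)
    (hφ : Continuous φ) (p : A) : ContinuousOn (G.logPsi N φ p) (G.fibre core (G.target p)) :=
  continuousOn_fibre_of_uncurry (h.continuousOn_logPsi hcore hN hδ hφ) p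

variable [MeasurableSpace A] {μ : B → VectorMeasure A 𝕜} {T : ℝ≥0}

variable (𝕜 n) in
-- The new defect is the quotient of the two sides of the cocycle identity, with the three factors
-- depending on `l` replaced by their averages.
lemma psi_correct (k p : A) : G.psi (G.correct μ N φ) k p =
    ((φ p)⁻¹ * mdlExp 𝕜 n H (G.logAverage μ N φ k) * φ p *
      mdlExp 𝕜 n H (G.logAverage μ N φ p))⁻¹ *
      (G.psi φ k p * mdlExp 𝕜 n H (G.logAverage μ N φ (G.mul k p))) := by
  have h : ∀ p, G.correct μ N φ p = φ p * mdlExp 𝕜 n H (G.logAverage μ N φ p) := fun _ => rfl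
  simp only [psi, h]
  group

variable [T2Space A] [BorelSpace A]

lemma HasSmallDefect.norm_logAverage_le (h : G.HasSmallDefect n core φ δ) (hN : IsLieNorm N)
    (hcore : G.IsSProperCore core) (hμ : G.IsHaarDensity core μ)
    (hδ : ∀ v : Mdl 𝕜 n, ‖v‖ ≤ δ → mdlNorm N v ≤ 1) (hT : ∀ z, (μ z).variation univ ≤ T)
    (hδ0 : 0 ≤ δ) (p : A) : ‖G.logAverage μ N φ p‖ ≤ T * δ := by
  rw [mul_comm]
  refine norm_integralAgainst_le (hT _) hδ0 ?_
  filter_upwards [hμ.ae_mem_fibre hcore (G.target p)] with k hk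
  exact (h.logPsi hN hδ hk).2.1

/-- Averaging the linearised cocycle identity. -/
lemma norm_linearisation_average_le (hcore : G.IsSProperCore core) (hμ : G.IsHaarDensity core μ)
    (hT : ∀ z, (μ z).variation univ ≤ T)
    (hc : ∀ p, ContinuousOn (G.logPsi N φ p) (G.fibre core (G.target p)))
    {k p : A} (hkp : (k, p) ∈ G.corePairs core) {c : ℝ} (hc0 : 0 ≤ c) (x : Mdl 𝕜 n)
    {Λ₁ Λ : Mdl 𝕜 n × Mdl 𝕜 n →L[𝕜] Mdl 𝕜 n}
    (hΛ : ∀ l ∈ G.fibre core (G.target k), ‖Λ₁ (x, G.logPsi N φ (G.mul k p) l) -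
      Λ (G.logPsi N φ k l, G.logPsi N φ p (G.mul l k))‖ ≤ c) :
    ‖Λ₁ (x, G.logAverage μ N φ (G.mul k p)) -
      Λ (G.logAverage μ N φ k, G.logAverage μ N φ p)‖ ≤ c * T := by
  have hfin : IsFiniteMeasure (μ (G.target k)).variation := ⟨(hT _).trans_lt ENNReal.coe_lt_top⟩
  have htq : G.target (G.mul k p) = G.target k := G.target_mul _ _ (hcore.no_escape hkp)
  have hsk : G.source k = G.target p := hkp.2
  have hy := hc (G.mul k p)
  rw [htq] at hy
  have hz : ContinuousOn (G.logPsi N φ p) (G.fibre core (G.source k)) := hsk ▸ hc p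
  have hz' : ContinuousOn (fun l => G.logPsi N φ p (G.mul l k)) (G.fibre core (G.target k)) :=
    hz.comp (hcore.continuousOn_mul_right k) (hcore.right_mul k hkp.1).1
  have iy := hμ.integrable hcore _ hy
  have iw := hμ.integrable hcore _ (hc k)
  have iz := hμ.integrable hcore _ hz'
  have ey : G.logAverage μ N φ (G.mul k p) =
      integralAgainst (μ (G.target k)) (G.logPsi N φ (G.mul k p)) := by rw [logAverage, htq]
  -- The use of right invariance: substituting `lk` for `l` moves the average from the fibre over
  -- `s(k) = t(p)` to the one over `t(k)`.
  have ez : G.logAverage μ N φ p =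
      integralAgainst (μ (G.target k)) (fun l => G.logPsi N φ p (G.mul l k)) := by
    rw [hμ.integralAgainst_mul_right hcore hkp.1 hz, hsk, logAverage]
  have hsplit : ∀ (M : Mdl 𝕜 n × Mdl 𝕜 n →L[𝕜] Mdl 𝕜 n) (u v : Mdl 𝕜 n), M (u, v) =
      (M ∘L .inl 𝕜 (Mdl 𝕜 n) (Mdl 𝕜 n)) u + (M ∘L .inr 𝕜 (Mdl 𝕜 n) (Mdl 𝕜 n)) v := by
    intro M u v
    simp [← map_add]
  have iM : ∀ (M : Mdl 𝕜 n →L[𝕜] Mdl 𝕜 n) (f : A → Mdl 𝕜 n), (μ (G.target k)).Integrable f →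
      (μ (G.target k)).Integrable fun l => M (f l) := fun M f hf => M.integrable_comp hf
  have key : Λ₁ (x, G.logAverage μ N φ (G.mul k p)) -
      Λ (G.logAverage μ N φ k, G.logAverage μ N φ p) =
      integralAgainst (μ (G.target k)) fun l => Λ₁ (x, G.logPsi N φ (G.mul k p) l) -
        Λ (G.logPsi N φ k l, G.logPsi N φ p (G.mul l k)) := by
    simp_rw [hsplit]
    have ic : (μ (G.target k)).Integrable
        fun _ => (Λ₁ ∘L .inl 𝕜 (Mdl 𝕜 n) (Mdl 𝕜 n)) x := integrable_const _
    have e1 := VectorMeasure.integral_fun_sub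
      (B := (ContinuousLinearMap.lsmul ℝ 𝕜 : 𝕜 →L[ℝ] Mdl 𝕜 n →L[ℝ] Mdl 𝕜 n).flip)
      (ic.add (iM (Λ₁ ∘L .inr 𝕜 (Mdl 𝕜 n) (Mdl 𝕜 n)) _ iy))
      ((iM (Λ ∘L .inl 𝕜 (Mdl 𝕜 n) (Mdl 𝕜 n)) _ iw).add
        (iM (Λ ∘L .inr 𝕜 (Mdl 𝕜 n) (Mdl 𝕜 n)) _ iz))
    have e2 := VectorMeasure.integral_add
      (B := (ContinuousLinearMap.lsmul ℝ 𝕜 : 𝕜 →L[ℝ] Mdl 𝕜 n →L[ℝ] Mdl 𝕜 n).flip)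
      ic (iM (Λ₁ ∘L .inr 𝕜 (Mdl 𝕜 n) (Mdl 𝕜 n)) _ iy)
    have e3 := VectorMeasure.integral_add
      (B := (ContinuousLinearMap.lsmul ℝ 𝕜 : 𝕜 →L[ℝ] Mdl 𝕜 n →L[ℝ] Mdl 𝕜 n).flip)
      (iM (Λ ∘L .inl 𝕜 (Mdl 𝕜 n) (Mdl 𝕜 n)) _ iw) (iM (Λ ∘L .inr 𝕜 (Mdl 𝕜 n) (Mdl 𝕜 n)) _ iz)
    refine Eq.trans ?_ e1.symm
    refine congrArg₂ (· - ·) (Eq.trans ?_ e2.symm) (Eq.trans ?_ e3.symm)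
    · refine congrArg₂ (· + ·) (hμ.integralAgainst_const _ _).symm ?_
      rw [ey]
      exact (integralAgainst_clm _ _ iy).symm
    · refine congrArg₂ (· + ·) (integralAgainst_clm _ _ iw).symm ?_
      rw [ez]
      exact (integralAgainst_clm _ _ iz).symm
  rw [key]
  refine norm_integralAgainst_le (hT _) hc0 ?_
  filter_upwards [hμ.ae_mem_fibre hcore (G.target k)] with l hl
  exact hΛ l hl

variable [LieGroup 𝓘(𝕜, Mdl 𝕜 n) ω H] [IsManifold 𝓘(𝕜, Mdl 𝕜 a) ω A]
  [T2Space B] [IsManifold 𝓘(𝕜, Mdl 𝕜 b) ω B]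

lemma HasSmallDefect.continuous_logAverage (h : G.HasSmallDefect n core φ δ) (hN : IsLieNorm N)
    (hcore : G.IsSProperCore core) (hμ : G.IsHaarDensity core μ)
    (hδ : ∀ v : Mdl 𝕜 n, ‖v‖ ≤ δ → mdlNorm N v ≤ 1) (hT : ∀ z, (μ z).variation univ ≤ T)
    (hφ : Continuous φ) : Continuous (G.logAverage μ N φ) :=
  hcore.continuous_integralAgainst hμ (fun z => ⟨(hT z).trans_lt ENNReal.coe_lt_top⟩)
    G.continuous_source G.continuous_target (h.continuousOn_logPsi hcore hN hδ hφ)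

/-- One step of the iteration halves a small defect. -/
theorem exists_correct_step [T2Space H] (hN : IsLieNorm N) {K : Set H} (hK : IsCompact K) {T : ℝ≥0}
    (hT1 : 1 ≤ T) : ∃ r > 0, ∀ (a b : ℕ) (A : Type u) (B : Type v)
      [TopologicalSpace A] [T2Space A] [ChartedSpace (Mdl 𝕜 a) A] [IsManifold 𝓘(𝕜, Mdl 𝕜 a) ω A]
      [MeasurableSpace A] [BorelSpace A]
      [TopologicalSpace B] [T2Space B] [ChartedSpace (Mdl 𝕜 b) B] [IsManifold 𝓘(𝕜, Mdl 𝕜 b) ω B]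
      (G : LocalAnalyticGroupoid 𝕜 a b A B) (core : Set A) (μ : B → VectorMeasure A 𝕜)
      (φ : A → H) (δ : ℝ), G.IsSProperCore core → G.IsHaarDensity core μ →
      (∀ z, (μ z).variation univ ≤ T) → Continuous φ → (∀ p, φ p ∈ K) → 0 ≤ δ → δ ≤ r →
      G.HasSmallDefect n core φ δ →
      (∀ x ∈ G.corePairs core, G.psi φ x.1 x.2 ∈ expBall N) ∧
      (∀ p, (μ (G.target p)).Integrable (G.logPsi N φ p)) ∧
      Continuous (G.correct μ N φ) ∧ G.HasSmallDefect n core (G.correct μ N φ) (δ / 2) ∧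
      ∀ p, ∃ v : Mdl 𝕜 n, ‖v‖ ≤ T * δ ∧ G.correct μ N φ p = φ p * mdlExp 𝕜 n H v := by
  obtain ⟨r₁, hr₁, C, hC, h₁⟩ := hN.exists_linearisation hK
  obtain ⟨r₂, hr₂, h₂⟩ := hN.exists_ball
  have hT0 : (0 : ℝ) < T := lt_of_lt_of_le one_pos (by exact_mod_cast hT1)
  have hT1' : (1 : ℝ) ≤ T := by exact_mod_cast hT1
  -- The first bound puts `Tδ`, the common size of the logarithms and their averages, within range;
  -- the second makes the final error `C((Tδ)² + C(Tδ)²T)` at most `δ/2`.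
  refine ⟨min (min r₁ r₂ / T) (1 / (2 * (C * (T ^ 2 + C * T ^ 2 * T)))), by positivity, ?_⟩
  intro a b A B _ _ _ _ _ _ _ _ _ _ G core μ φ δ hcore hμ hT hφ hφK hδ0 hδr h
  have : IsTopologicalGroup H := topologicalGroup_of_lieGroup 𝓘(𝕜, Mdl 𝕜 n) ω
  have hTδ : T * δ ≤ min r₁ r₂ := by
    have := hδr.trans (min_le_left _ _)
    rw [le_div_iff₀ hT0] at this
    linarith
  have hδT : δ ≤ T * δ := le_mul_of_one_le_left hδ0 hT1'
  have hball : ∀ v : Mdl 𝕜 n, ‖v‖ ≤ T * δ → mdlNorm N v ≤ 1 := fun v hv =>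
    (h₂ v (hv.trans (hTδ.trans (min_le_right _ _)))).le
  have hδ : ∀ v : Mdl 𝕜 n, ‖v‖ ≤ δ → mdlNorm N v ≤ 1 := fun v hv => hball v (hv.trans hδT)
  have hc := h.continuousOn_fibre_logPsi hN hcore hδ hφ
  have hα := h.norm_logAverage_le hN hcore hμ hδ hT hδ0
  have hfin : ∀ z, IsFiniteMeasure (μ z).variation := fun z => ⟨(hT z).trans_lt ENNReal.coe_lt_top⟩
  refine ⟨fun x hx => (h.logPsi hN hδ hx).1, fun p => hμ.integrable hcore _ (hc p), ?_, ?_,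
    fun p => ⟨_, hα p, rfl⟩⟩
  · refine hφ.mul (continuous_iff_continuousAt.2 fun p => ?_)
    exact (hN.contMDiffAt_mdlExp (hball _ (hα p))).continuousAt.comp
      (f := G.logAverage μ N φ) (h.continuous_logAverage hN hcore hμ hδ hT hφ).continuousAt
  · rintro ⟨k, p⟩ hkp
    obtain ⟨Λ₁, Λ, hΛ⟩ := h₁ (φ p) (hφK p)
    have hq := G.target_mul _ _ (hcore.no_escape hkp)
    have hx := h.logPsi hN hδ hkp
    have hΛl : ∀ l ∈ G.fibre core (G.target k), ‖Λ₁ (G.logPsi N φ p k,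
        G.logPsi N φ (G.mul k p) l) - Λ (G.logPsi N φ k l, G.logPsi N φ p (G.mul l k))‖ ≤
        C * (T * δ) ^ 2 := by
      intro l hl
      have hlk := hcore.right_mul k hkp.1 |>.1 hl
      have hy := h.logPsi hN hδ (k := l) (p := G.mul k p) ⟨hl.1, hl.2.trans hq.symm⟩
      have hw := h.logPsi hN hδ (k := l) (p := k) hl
      have hz := h.logPsi hN hδ (k := G.mul l k) (p := p) ⟨hlk.1, hlk.2.trans hkp.2⟩
      refine (hΛ _ (hTδ.trans (min_le_left _ _)) _ _ _ _ (hx.2.1.trans hδT) (hy.2.1.trans hδT)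
        (hw.2.1.trans hδT) (hz.2.1.trans hδT)).1 ?_
      rw [hx.2.2, hy.2.2, hw.2.2, hz.2.2]
      exact hcore.psi_mul_psi φ hkp hl
    have hΛα := norm_linearisation_average_le hcore hμ hT hc hkp (by positivity) _ hΛl
    obtain ⟨m, hme, hm⟩ := (hΛ _ (hTδ.trans (min_le_left _ _)) _ _ _ _ (hx.2.1.trans hδT)
      (hα (G.mul k p)) (hα k) (hα p)).2
    refine ⟨m, hm.trans ?_, ?_⟩
    · have h3 : δ * (2 * (C * (T ^ 2 + C * T ^ 2 * T))) ≤ 1 := by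
        have := hδr.trans (min_le_right _ _)
        rwa [le_div_iff₀ (by positivity)] at this
      calc C * ((T * δ) ^ 2 + ‖_‖) ≤ C * ((T * δ) ^ 2 + C * (T * δ) ^ 2 * T) := by gcongr
        _ = (δ * (2 * (C * (T ^ 2 + C * T ^ 2 * T)))) * (δ / 2) := by ring
        _ ≤ 1 * (δ / 2) := by gcongr
        _ = δ / 2 := one_mul _
    · rw [hme, psi_correct 𝕜 n, hx.2.2]

end LocalAnalyticGroupoid

end

/-! ### Convergence of the iteration. -/

theorem theoremA {𝕜 : Type} [RCLike 𝕜] {n : ℕ} {H : Type w} [TopologicalSpace H] [T2Space H]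
    [ChartedSpace (Mdl 𝕜 n) H] [Group H] [LieGroup 𝓘(𝕜, Mdl 𝕜 n) ω H]
    (N : NormedLie.Alg 𝕜 n H → ℝ) (hN : NormedLie.IsLieNorm N)
    (W K : Set H) (hW : IsOpen W) (hW1 : (1 : H) ∈ W) (hK : IsCompact K)
    (hWK : closure W ⊆ interior K) (T : ℝ≥0) :
    ∃ C : ℝ, 0 < C ∧
      ∀ (a b : ℕ) (A : Type u) (B : Type v)
        [TopologicalSpace A] [T2Space A] [SecondCountableTopology A]
        [ChartedSpace (Mdl 𝕜 a) A] [IsManifold 𝓘(𝕜, Mdl 𝕜 a) ω A]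
        [MeasurableSpace A] [BorelSpace A]
        [TopologicalSpace B] [T2Space B] [SecondCountableTopology B]
        [ChartedSpace (Mdl 𝕜 b) B] [IsManifold 𝓘(𝕜, Mdl 𝕜 b) ω B]
        (G : LocalAnalyticGroupoid 𝕜 a b A B) (core : Set A) (μ : B → VectorMeasure A 𝕜)
        (φ : A → H),
        G.IsSProperCore core → G.IsHaarDensity core μ →
        (∀ z, (μ z).variation univ ≤ T) →
        ContMDiff 𝓘(𝕜, Mdl 𝕜 a) 𝓘(𝕜, Mdl 𝕜 n) ω φ →
        (∀ p, φ p ∈ W) → G.defect core N φ ≤ ENNReal.ofReal C →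
        (∀ m : ℕ, Continuous ((G.correct μ N)^[m] φ) ∧
          (∀ x ∈ G.corePairs core,
            G.psi ((G.correct μ N)^[m] φ) x.1 x.2 ∈ NormedLie.expBall N) ∧
          ∀ p, (μ (G.target p)).Integrable (G.logPsi N ((G.correct μ N)^[m] φ) p)) ∧
        ∃ Φ : A → H, Continuous Φ ∧
          (∀ L : Set A, IsCompact L → ∀ ε : ℝ≥0∞, 0 < ε → ∀ᶠ m in atTop,
            ∀ p ∈ L, NormedLie.finslerEDist N ((G.correct μ N)^[m] φ p) (Φ p) ≤ ε) ∧
          ∀ x ∈ G.corePairs core, Φ (G.mul x.1 x.2) = Φ x.1 * Φ x.2 := by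
  have hgrp : IsTopologicalGroup H := topologicalGroup_of_lieGroup 𝓘(𝕜, Mdl 𝕜 n) ω
  have hWc : IsCompact (closure W) :=
    hK.of_isClosed_subset isClosed_closure (hWK.trans interior_subset)
  -- Right perturbations in `V` keep values from `W` inside `K`, so a single step radius serves all
  -- iterates.
  obtain ⟨V, hV, hWV⟩ := compact_open_separated_mul_right hWc isOpen_interior hWK
  obtain ⟨r₁, hr₁, hstep⟩ := LocalAnalyticGroupoid.exists_correct_step.{u, v} hN hK
    (T := T + 1) le_add_self
  obtain ⟨r₂, hr₂, hball⟩ := hN.exists_ball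
  obtain ⟨r₃, hr₃, L₃, hL₃, hmul⟩ := hN.exists_mul_sub_le
  obtain ⟨r₄, hr₄, L₄, hL₄, hinv⟩ := hN.exists_inv_mul_le
  obtain ⟨r₅, hr₅, M, hM, hdist⟩ := hN.exists_finslerEDist_mul_le
  have hexp0 : ContinuousAt (NormedLie.mdlExp 𝕜 n H) 0 :=
    (hN.contMDiffAt_mdlExp (by rw [hN.mdlNorm_zero]; exact zero_le_one)).continuousAt
  obtain ⟨r₆, hr₆, hV6⟩ : ∃ r > 0, ∀ v : Mdl 𝕜 n, ‖v‖ ≤ r → NormedLie.mdlExp 𝕜 n H v ∈ V := by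
    have h1 : NormedLie.mdlExp 𝕜 n H ⁻¹' V ∈ 𝓝 0 :=
      hexp0 (by rwa [NormedLie.mdlExp_zero])
    obtain ⟨r, hr, h⟩ := Metric.nhds_basis_closedBall.mem_iff.1 h1
    exact ⟨r, hr, fun v hv => h (by simpa using hv)⟩
  set T' : ℝ≥0 := T + 1 with hT'
  have hT'1 : (1 : ℝ) ≤ T' := by exact_mod_cast (le_add_self : (1 : ℝ≥0) ≤ T + 1)
  set R := min (min r₂ r₃) (min r₄ r₆) with hR
  have hR0 : 0 < R := by positivity
  -- `r₁` permits the step, `r₃ / T'` keeps each correction in range of `hmul`, and the last term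
  -- keeps the total displacement within `R`.
  set δ := min (min r₁ (r₃ / T')) (R / (2 * L₃ * T')) with hδ
  have hT'0 : (0 : ℝ) < T' := one_pos.trans_le hT'1
  have hδ0 : 0 < δ := by positivity
  obtain ⟨C, hC, hCδ⟩ := hN.exists_of_finslerEDist_one_le hδ0
  refine ⟨C, hC, ?_⟩
  intro a b A B _ _ _ _ _ _ _ _ _ _ _ _ G core μ φ hcore hμ hT hφ hφW hdef
  have hT2 : ∀ z, (μ z).variation univ ≤ T' := fun z =>
    (hT z).trans (by exact_mod_cast (le_self_add : T ≤ T + 1))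
  have hφc : Continuous φ := hφ.continuous
  have hδr₁ : δ ≤ r₁ := (min_le_left _ _).trans (min_le_left _ _)
  have hδr₃ : T' * δ ≤ r₃ := by
    have := (min_le_left _ _ : δ ≤ _).trans (min_le_right _ _)
    rw [le_div_iff₀ hT'0] at this
    linarith
  -- The sum of the geometric series of displacements `L₃ T' δ / 2 ^ m`; after `m` steps at most `S
  -- (1 - 1 / 2 ^ m)` is used up.
  set S := 2 * (L₃ * (T' * δ)) with hS
  have hSR : S ≤ R := by
    have := (min_le_right _ _ : δ ≤ _)
    rw [le_div_iff₀ (by positivity)] at this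
    linarith
  have hS0 : 0 ≤ S := by positivity
  set φs : ℕ → A → H := fun m => (G.correct μ N)^[m] φ with hφs
  have hsucc : ∀ m, φs (m + 1) = G.correct μ N (φs m) := fun m =>
    Function.iterate_succ_apply' _ _ _
  have hRball : ∀ v : Mdl 𝕜 n, ‖v‖ ≤ R → NormedLie.mdlNorm N v ≤ 1 := fun v hv =>
    (hball v (hv.trans ((min_le_left _ _).trans (min_le_left _ _)))).le
  have hRK : ∀ p (v : Mdl 𝕜 n), ‖v‖ ≤ R → φ p * NormedLie.mdlExp 𝕜 n H v ∈ K := fun p v hv =>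
    interior_subset (hWV (mul_mem_mul (subset_closure (hφW p))
      (hV6 v (hv.trans ((min_le_right _ _).trans (min_le_right _ _))))))
  -- the iterates are `φ exp β`, with a sequence `β` that converges geometrically
  set β : ℕ → A → Mdl 𝕜 n := fun m p => NormedLie.mdlLog N ((φ p)⁻¹ * φs m p) with hβ
  have hpow : ∀ m : ℕ, (1 : ℝ) / 2 ^ m ≤ 1 := fun m =>
    (div_le_one (by positivity)).2 (one_le_pow₀ (by norm_num))
  have hδm : ∀ m : ℕ, 0 ≤ δ / 2 ^ m ∧ δ / 2 ^ m ≤ δ := fun m =>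
    ⟨by positivity, div_le_self hδ0.le (one_le_pow₀ (by norm_num))⟩
  have hSm : ∀ m : ℕ, S * (1 - 1 / 2 ^ m) ≤ R := fun m => by
    have : 0 ≤ S * (1 / 2 ^ m) := by positivity
    nlinarith
  have hβ_of : ∀ m p (v : Mdl 𝕜 n), ‖v‖ ≤ R → φs m p = φ p * NormedLie.mdlExp 𝕜 n H v →
      β m p = v := fun m p v hv h => by
    simp only [hβ, h, inv_mul_cancel_left]
    exact hN.mdlLog_mdlExp (hRball v hv)
  have hone : ∀ m, Continuous (φs m) → G.HasSmallDefect n core (φs m) (δ / 2 ^ m) →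
      (∀ p, ‖β m p‖ ≤ S * (1 - 1 / 2 ^ m) ∧
        φs m p = φ p * NormedLie.mdlExp 𝕜 n H (β m p)) →
      (∀ x ∈ G.corePairs core, G.psi (φs m) x.1 x.2 ∈ NormedLie.expBall N) ∧
      (∀ p, (μ (G.target p)).Integrable (G.logPsi N (φs m) p)) ∧
      Continuous (G.correct μ N (φs m)) ∧
      G.HasSmallDefect n core (G.correct μ N (φs m)) (δ / 2 ^ m / 2) ∧
      ∀ p, ∃ v : Mdl 𝕜 n, ‖v‖ ≤ T' * (δ / 2 ^ m) ∧
        G.correct μ N (φs m) p = φs m p * NormedLie.mdlExp 𝕜 n H v := by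
    intro m h1 h2 h3
    exact hstep a b A B G core μ (φs m) (δ / 2 ^ m) hcore hμ hT2 h1
      (fun p => by rw [(h3 p).2]; exact hRK p _ ((h3 p).1.trans (hSm m)))
      (hδm m).1 ((hδm m).2.trans hδr₁) h2
  have hnext : ∀ m p, ‖β m p‖ ≤ S * (1 - 1 / 2 ^ m) →
      φs m p = φ p * NormedLie.mdlExp 𝕜 n H (β m p) →
      (∃ v : Mdl 𝕜 n, ‖v‖ ≤ T' * (δ / 2 ^ m) ∧
        G.correct μ N (φs m) p = φs m p * NormedLie.mdlExp 𝕜 n H v) →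
      ‖β (m + 1) p - β m p‖ ≤ S / 2 / 2 ^ m ∧ ‖β (m + 1) p‖ ≤ S * (1 - 1 / 2 ^ (m + 1)) ∧
        φs (m + 1) p = φ p * NormedLie.mdlExp 𝕜 n H (β (m + 1) p) := by
    rintro m p h1 h2 ⟨v, hv, hve⟩
    have h3 : T' * (δ / 2 ^ m) ≤ r₃ := (mul_le_mul_of_nonneg_left (hδm m).2 hT'0.le).trans hδr₃
    obtain ⟨w, hwe, hw⟩ := hmul (β m p) v
      (h1.trans ((hSm m).trans ((min_le_left _ _).trans (min_le_right _ _)))) (hv.trans h3)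
    have h4 : φs (m + 1) p = φ p * NormedLie.mdlExp 𝕜 n H w := by
      rw [hsucc, hve, h2, hwe, mul_assoc]
    have h5 : ‖w - β m p‖ ≤ S / 2 / 2 ^ m := by
      refine hw.trans ((mul_le_mul_of_nonneg_left hv hL₃.le).trans_eq ?_)
      rw [hS]
      ring
    have h6 : ‖w‖ ≤ S * (1 - 1 / 2 ^ (m + 1)) := by
      have h7 : ‖w‖ ≤ ‖w - β m p‖ + ‖β m p‖ := by simpa using norm_add_le (w - β m p) (β m p)
      refine h7.trans ((add_le_add h5 h1).trans_eq ?_)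
      rw [pow_succ]
      field_simp
      ring
    rw [hβ_of (m + 1) p w (h6.trans (hSm _)) h4]
    exact ⟨h5, h6, h4⟩
  have hinvar : ∀ m, Continuous (φs m) ∧ G.HasSmallDefect n core (φs m) (δ / 2 ^ m) ∧
      ∀ p, ‖β m p‖ ≤ S * (1 - 1 / 2 ^ m) ∧
        φs m p = φ p * NormedLie.mdlExp 𝕜 n H (β m p) := by
    intro m
    induction m with
    | zero =>
      refine ⟨hφc, fun x hx => ?_, fun p => ?_⟩
      · obtain ⟨v, hv, hve⟩ := hCδ _ ((le_iSup₂ (f := fun (x : A × A)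
          (_ : x ∈ G.corePairs core) =>
          NormedLie.finslerEDist N (G.psi φ x.1 x.2) 1) x hx).trans hdef)
        exact ⟨v, by simpa using hv, hve⟩
      · have h0 : β 0 p = 0 := hβ_of 0 p 0 (by simpa using hR0.le)
          (by simp [hφs, NormedLie.mdlExp_zero])
        rw [h0]
        simp [hφs, NormedLie.mdlExp_zero]
    | succ m ih =>
      obtain ⟨h1, h2, h3⟩ := ih
      obtain ⟨-, -, h4, h5, h6⟩ := hone m h1 h2 h3
      refine ⟨by rwa [hsucc], ?_, fun p => (hnext m p (h3 p).1 (h3 p).2 (h6 p)).2⟩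
      rw [hsucc, pow_succ, ← div_div]
      exact h5
  have hall := fun m => hone m (hinvar m).1 (hinvar m).2.1 (hinvar m).2.2
  refine ⟨fun m => ⟨(hinvar m).1, (hall m).1, (hall m).2.1⟩, ?_⟩
  have hβR : ∀ m p, ‖β m p‖ ≤ R := fun m p => ((hinvar m).2.2 p).1.trans (hSm m)
  have hβd : ∀ p m, dist (β m p) (β (m + 1) p) ≤ S / 2 / 2 ^ m := fun p m => by
    rw [dist_comm, dist_eq_norm]
    exact (hnext m p ((hinvar m).2.2 p).1 ((hinvar m).2.2 p).2 ((hall m).2.2.2.2 p)).1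
  -- The limit is taken in the vector space of exponents, where the convergence rate is uniform in
  -- `p`.
  choose γ hγ using fun p => cauchySeq_tendsto_of_complete (cauchySeq_of_le_geometric_two (hβd p))
  have hγd : ∀ m p, ‖β m p - γ p‖ ≤ S / 2 ^ m := fun m p => by
    rw [← dist_eq_norm]
    exact dist_le_of_le_geometric_two_of_tendsto (hβd p) (hγ p) m
  have hγR : ∀ p, ‖γ p‖ ≤ R := fun p => le_of_tendsto (hγ p).norm (Eventually.of_forall fun m => hβR m p)
  have hgeom : ∀ c : ℝ, Tendsto (fun m : ℕ => c / 2 ^ m) atTop (𝓝 0) := fun c =>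
    tendsto_const_nhds.div_atTop (tendsto_pow_atTop_atTop_of_one_lt one_lt_two)
  have hβc : ∀ m, Continuous (β m) := fun m => by
    refine hN.continuousOn_mdlLog.comp_continuous (hφc.inv.mul (hinvar m).1) fun p => ?_
    rw [((hinvar m).2.2 p).2, inv_mul_cancel_left]
    exact NormedLie.IsLieNorm.mdlExp_mem_expBall (hRball _ (hβR m p))
  have hγc : Continuous γ := by
    refine TendstoUniformly.continuous (F := β) (p := atTop) ?_ (Frequently.of_forall hβc)
    rw [Metric.tendstoUniformly_iff]
    intro ε hε
    filter_upwards [(hgeom S).eventually_lt_const hε] with m hm p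
    rw [dist_comm, dist_eq_norm]
    exact (hγd m p).trans_lt hm
  have hexpγ : ∀ p, ContinuousAt (NormedLie.mdlExp 𝕜 n H) (γ p) := fun p =>
    (hN.contMDiffAt_mdlExp (hRball _ (hγR p))).continuousAt
  have hlim : ∀ p, Tendsto (fun m => φs m p) atTop (𝓝 (φ p * NormedLie.mdlExp 𝕜 n H (γ p))) := by
    intro p
    refine (((hexpγ p).tendsto.comp (hγ p)).const_mul (φ p)).congr fun m => ?_
    exact ((hinvar m).2.2 p).2.symm
  refine ⟨fun p => φ p * NormedLie.mdlExp 𝕜 n H (γ p), ?_, ?_, ?_⟩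
  · exact hφc.mul (continuous_iff_continuousAt.2 fun p =>
      (hexpγ p).comp (f := γ) hγc.continuousAt)
  · intro L _ ε hε
    have h1 : Tendsto (fun m : ℕ => ENNReal.ofReal (M * (L₄ * S / 2 ^ m))) atTop (𝓝 0) := by
      simpa using ENNReal.tendsto_ofReal ((hgeom (L₄ * S)).const_mul M)
    filter_upwards [h1.eventually_le_const hε, (hgeom (L₄ * S)).eventually_le_const hr₅]
      with m hm hm5 p _
    have hRr : R ≤ r₄ := (min_le_right _ _).trans (min_le_left _ _)
    obtain ⟨w, hwe, hw⟩ := hinv (β m p) (γ p) ((hβR m p).trans hRr) ((hγR p).trans hRr)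
    have hw' : ‖w‖ ≤ L₄ * S / 2 ^ m := by
      refine hw.trans ((mul_le_mul_of_nonneg_left (hγd m p) hL₄.le).trans_eq ?_)
      ring
    have h2 : φ p * NormedLie.mdlExp 𝕜 n H (γ p) = φs m p * NormedLie.mdlExp 𝕜 n H w := by
      rw [hwe, ((hinvar m).2.2 p).2]
      group
    rw [h2]
    refine (hdist (φs m p) w (hw'.trans hm5)).trans (le_trans ?_ hm)
    exact ENNReal.ofReal_le_ofReal (mul_le_mul_of_nonneg_left hw' hM.le)
  · intro x hx
    set Φ : A → H := fun p => φ p * NormedLie.mdlExp 𝕜 n H (γ p) with hΦ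
    have h1 : Tendsto (fun m => G.psi (φs m) x.1 x.2) atTop (𝓝 (G.psi Φ x.1 x.2)) :=
      ((hlim x.2).inv.mul (hlim x.1).inv).mul (hlim _)
    -- The defects are exponentials of vectors of norm at most `δ / 2 ^ m`, so they tend to `1`; by
    -- pointwise convergence of the iterates they also tend to the defect of `Φ`.
    choose v hv hve using fun m => (hinvar m).2.1 x hx
    have h2 : Tendsto v atTop (𝓝 0) :=
      squeeze_zero_norm hv (hgeom δ)
    have h3 : Tendsto (fun m => G.psi (φs m) x.1 x.2) atTop (𝓝 1) := by
      have := hexp0.tendsto.comp h2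
      rw [NormedLie.mdlExp_zero] at this
      exact this.congr hve
    have h4 : (Φ x.2)⁻¹ * (Φ x.1)⁻¹ * Φ (G.mul x.1 x.2) = 1 := tendsto_nhds_unique h1 h3
    rw [← mul_inv_rev] at h4
    exact (inv_mul_eq_one.1 h4).symm
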